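/- Let $\alpha,\beta,\xi\in\mathbb C$ with $\alpha+\beta\notin\{-2,-3,-4,\dots\}$. Let $\gamma$ be a Pochhammer-type contour: a closed (piecewise smooth) curve in $\mathbb C\setminus\{1,-1\}$, starting in $(-1,1)$, that encircles $+1$ and then $-1$ once in the positive sense, and then $+1$ and $-1$ once in the negative sense. The circuits around $+1$ do not meet $(-\infty,-1]$, the circuits around $-1$ do not meet $[1,\infty)$, and between consecutive circuits the curve passes through $(-1,1)$. Let $\omega(z;\alpha,\beta)=(1-z)^\alpha(1+z)^\beta$, continued analytically along $\gamma$ from the branch given at the starting point by the real logarithms of $1-z$ and $1+z$. Let $$P_n^{(\alpha,\beta)}(z)=\sum_{k=0}^n\binom nk\frac{(\alpha+k+1)_{n-k}}{(\alpha+\beta+n+k+1)_{n-k}}\,2^{n-k}(z-1)^k$$ be the monic Jacobi polynomials, $\|P_n^{(\alpha,\beta)}\|^2=\int_\gamma (P_n^{(\alpha,\beta)}(z))^2\,\omega(z;\alpha,\beta)\,dz$, and let $P_n$ be the polar Jacobi polynomial with pole $\xi$, i.e. $(z-\xi)P_n(z)$ is the primitive of $(n+1)P_n^{(\alpha,\beta)}$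 that vanishes at $\xi$. Then, for all $n,m\ge 0$, $$\int_\gamma \bigl(P_n(z)+(z-\xi)P_n'(z)\bigr)P_m^{(\alpha,\beta)}(z)\,\omega(z;\alpha,\beta)\,dz=\begin{cases}0,&m\ne n,\\ (n+1)\|P_n^{(\alpha,\beta)}\|^2,&m=n.\end{cases}$$ Furthermore, if $n>1$, then $$\int_\gamma (z-\xi)P_n(z)P_m^{(\alpha,\beta)}(z)\,\omega(z;\alpha,\beta)\,dz=\begin{cases} -\|P_0^{(\alpha,\beta)}\|^2\,P_{n+1}^{(\alpha-1,\beta-1)}(\xi),&m=0,\\ 0,&0<m<n-1,\\ \widetilde\gamma_n\|P_{n-1}^{(\alpha,\beta)}\|^2,&m=n-1,\\ \widetilde\beta_n\|P_n^{(\alpha,\beta)}\|^2,&m=n,\\ \|P_{n+1}^{(\alpha,\beta)}\|^2,&m=n+1,\\ 0,&m>n+1,\end{cases}$$ where $P_{n+1}^{(\alpha-1,\beta-1)}$ is given by the same formula with $n,\alpha,\beta$ replaced by $n+1,\alpha-1,\beta-1$, and $$\widetilde\beta_n=\frac{(2n+2)(\alpha-\beta)}{(\alpha+\beta+2n)(\alpha+\beta+2n+2)},\qquad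 \widetilde\gamma_n=-\frac{4n(n+1)(\alpha+n)(\beta+n)}{(\alpha+\beta+2n-1)(\alpha+\beta+2n)^2(\alpha+\beta+2n+1)}.$$ Here, for every $n\ge0$, $$\|P_n^{(\alpha,\beta)}\|^2=-\frac{4\pi^2e^{\pi i(\alpha+\beta)}\,2^{2n+\alpha+\beta+1}\,n!}{\Gamma(-\alpha-n)\Gamma(-\beta-n)\,(\alpha+\beta+n+1)_n\,\Gamma(\alpha+\beta+2n+2)}$$ (with $1/\Gamma$ equal to $0$ at the poles of $\Gamma$). If neither $\alpha$ nor $\beta$ is a negative integer, and $\alpha+\beta\neq-1$ in case $n=0$, this equals $$(1-e^{2\pi i\alpha})(1-e^{2\pi i\beta})\,\frac{2^{2n+\alpha+\beta+1}\,n!\,\Gamma(\alpha+n+1)\Gamma(\beta+n+1)\Gamma(\alpha+\beta+n+1)}{\Gamma(\alpha+\beta+2n+1)\Gamma(\alpha+\beta+2n+2)};$$ and if neither $\alpha$ nor $\beta$ is a negative integer, the moment for $m=0$ (and $n>1$) is $$-(1-e^{2\pi i\alpha})(1-e^{2\pi i\beta})\,\frac{2^{\alpha+\beta+1}\Gamma(\alpha+1)\Gamma(\beta+1)}{\Gamma(\alpha+\beta+2)}\,P_{n+1}^{(\alpha-1,\beta-1)}(\xi).$$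 -/

import Mathlib

open Polynomial

/-- The monic Jacobi polynomial `P_n^{(α,β)}`, for complex parameters, expanded in powers of
`z - 1` (the hypergeometric representation divided by its leading coefficient):
`∑ k, binom(n,k) * (α+k+1)_{n-k} / (α+β+n+k+1)_{n-k} * 2^(n-k) * (z-1)^k`,
where `(x)_j` is the rising factorial. -/
noncomputable def jacobiMonic (α β : ℂ) (n : ℕ) : ℂ[X] :=
  ∑ k ∈ Finset.range (n + 1),
    C ((n.choose k : ℂ) * (ascPochhammer ℂ (n - k)).eval (α + k + 1)
        / (ascPochhammer ℂ (n - k)).eval (α + β + n + k + 1) * 2 ^ (n - k))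
      * (X - C 1) ^ k

/-- The primitive of a polynomial that has constant term zero. -/
noncomputable def polyPrimitive (p : ℂ[X]) : ℂ[X] :=
  p.sum fun k c => monomial (k + 1) (c / ((k : ℂ) + 1))

/-- `Π_{n+1,ξ}`: the primitive of `(n+1) P_n^{(α,β)}` that has a zero at `ξ`. -/
noncomputable def jacobiPrimitive (α β ξ : ℂ) (n : ℕ) : ℂ[X] :=
  C ((n : ℂ) + 1) * (polyPrimitive (jacobiMonic α β n)
    - C ((polyPrimitive (jacobiMonic α β n)).eval ξ))

/-- The polar Jacobi polynomial `P_n` with pole `ξ`: the quotient of `Π_{n+1,ξ}` by `z - ξ`. -/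
noncomputable def polarJacobi (α β ξ : ℂ) (n : ℕ) : ℂ[X] :=
  jacobiPrimitive α β ξ n /ₘ (X - C ξ)

/-- The differential operator `L_ξ[f] = f + (z - ξ) f'` on polynomials. -/
noncomputable def polarOp (ξ : ℂ) (f : ℂ[X]) : ℂ[X] :=
  f + (X - C ξ) * derivative f

/-- A Pochhammer-type contour: a closed curve in `ℂ ∖ {1, -1}` that encircles `+1` and then `-1`
in the positive sense, and then `+1` and `-1` in the negative sense.

The curve is parametrized by `[0, 4]`; it is continuous and, outside a countable set,
differentiable, with integrable derivative (every piecewise `C¹` curve is so).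
`logR` and `logL` are the continuous logarithms of `1 - z` and `1 + z` along the curve with
imaginary part `0` at the starting point. At the times `0, 1, 2, 3, 4` the curve passes through the
open interval `(-1, 1)` (the imaginary parts of both logarithms are multiples of `2π` there).
On `[0, 1]` and on `[2, 3]` it does not meet `(-∞, -1]` and winds once around `+1`, positively and
negatively, respectively; on `[1, 2]` and on `[3, 4]` it does not meet `[1, ∞)` and winds once
around `-1`, positively and negatively, respectively. -/
structure PochhammerContour where
  path : ℝ → ℂ
  continuousOn_path : ContinuousOn path (Set.Icc 0 4)
  differentiableAt_path : ∃ S : Set ℝ, S.Countable ∧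
    ∀ t ∈ Set.Ioo (0 : ℝ) 4 \ S, DifferentiableAt ℝ path t
  intervalIntegrable_deriv :
    IntervalIntegrable (fun t => deriv path t) MeasureTheory.volume 0 4
  closed : path 4 = path 0
  logR : ℝ → ℂ
  logL : ℝ → ℂ
  continuousOn_logR : ContinuousOn logR (Set.Icc 0 4)
  continuousOn_logL : ContinuousOn logL (Set.Icc 0 4)
  exp_logR : ∀ t ∈ Set.Icc (0 : ℝ) 4, Complex.exp (logR t) = 1 - path t
  exp_logL : ∀ t ∈ Set.Icc (0 : ℝ) 4, Complex.exp (logL t) = 1 + path t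
  logR_zero : (logR 0).im = 0
  logL_zero : (logL 0).im = 0
  avoids_left_first : ∀ t ∈ Set.Icc (0 : ℝ) 1, 1 + path t ∈ Complex.slitPlane
  logR_one : (logR 1).im = 2 * Real.pi
  logL_one : (logL 1).im = 0
  avoids_right_second : ∀ t ∈ Set.Icc (1 : ℝ) 2, 1 - path t ∈ Complex.slitPlane
  logR_two : (logR 2).im = 2 * Real.pi
  logL_two : (logL 2).im = 2 * Real.pi
  avoids_left_third : ∀ t ∈ Set.Icc (2 : ℝ) 3, 1 + path t ∈ Complex.slitPlane
  logR_three : (logR 3).im = 0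
  logL_three : (logL 3).im = 2 * Real.pi
  avoids_right_fourth : ∀ t ∈ Set.Icc (3 : ℝ) 4, 1 - path t ∈ Complex.slitPlane
  logR_four : (logR 4).im = 0
  logL_four : (logL 4).im = 0

/-- The Jacobi weight `ω(z;α,β) = (1-z)^α (1+z)^β`, continued along the contour from its positive
branch (that is, with the real logarithms of `1 ± z`) at the starting point. -/
noncomputable def PochhammerContour.weight (γ : PochhammerContour) (α β : ℂ) (t : ℝ) : ℂ :=
  Complex.exp (α * γ.logR t + β * γ.logL t)

/-- The contour integral `∫_γ p(z) ω(z;α,β) dz` of a polynomial `p`. -/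
noncomputable def PochhammerContour.integral (γ : PochhammerContour) (α β : ℂ) (p : ℂ[X]) : ℂ :=
  ∫ t in (0 : ℝ)..4, p.eval (γ.path t) * γ.weight α β t * deriv γ.path t

/-- `‖P_n^{(α,β)}‖² = ∫_γ (P_n^{(α,β)}(z))² ω(z;α,β) dz` (no complex conjugation). -/
noncomputable def PochhammerContour.jacobiNormSq (γ : PochhammerContour) (α β : ℂ) (n : ℕ) : ℂ :=
  γ.integral α β (jacobiMonic α β n ^ 2)

/-- The coefficient `β̃_n` of the second structure relation. -/
noncomputable def betaTilde (α β : ℂ) (n : ℕ) : ℂ :=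
  (2 * n + 2) * (α - β) / ((α + β + 2 * n) * (α + β + 2 * n + 2))

/-- The coefficient `γ̃_n` of the second structure relation. -/
noncomputable def gammaTilde (α β : ℂ) (n : ℕ) : ℂ :=
  -(4 * n * (n + 1) * (α + n) * (β + n)) /
    ((α + β + 2 * n - 1) * (α + β + 2 * n) ^ 2 * (α + β + 2 * n + 1))

/-! Differentiating the monic Jacobi polynomial of degree `n + 1` with parameters `α - 1`, `β - 1`
gives `(n + 1)` times the one of degree `n` with parameters `α`, `β`. Hence `(z - ξ) P_n` is the
former polynomial minus its value at `ξ`, and `L_ξ[P_n]`, the derivative of `(z - ξ) P_n`, is a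
multiple of a Jacobi polynomial. The first claim is then orthogonality. The moments follow from
orthogonality and the three-term connection formula `jacobiMonic_sub_one_eq`; the value at `ξ` meets
only `m = 0`.

Orthogonality and norms rest on integration by parts. The weight returns to its initial value along
the whole contour, so `((1 - z²) p ω)'` integrates to zero. Together with the raising relation
`pearsonOp_jacobiMonic`, this trades `P_{n+1}^{(α,β)} p` for `P_n^{(α+1,β+1)} p'`. Iteration kills
polynomials of low degree and reduces every norm to the total mass of a shifted weight.

The total mass (`integral_one_eq`) is computed for positive real parts: on each circuit an Euler
integral supplies a primitive, and the four contributions combine to `(1 - e^{2πiα})(1 - e^{2πiβ})`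
times a beta integral. Both sides, written with `1/Γ`, are entire in each parameter, so the identity
theorem removes the restriction. -/

/-! ### Coefficients and degrees of the monic Jacobi polynomials -/

theorem ascPochhammer_succ_eval_left (n : ℕ) (x : ℂ) :
    (ascPochhammer ℂ (n + 1)).eval x = x * (ascPochhammer ℂ n).eval (x + 1) := by
  simp [ascPochhammer_succ_left, eval_comp]

theorem ascPochhammer_eval_ne_zero {n : ℕ} {x : ℂ} (h : ∀ j < n, x + (j : ℂ) ≠ 0) :
    (ascPochhammer ℂ n).eval x ≠ 0 := by
  induction n with
  | zero => simp
  | succ n ih =>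
    rw [ascPochhammer_succ_eval]
    exact mul_ne_zero (ih fun j hj => h j (hj.trans n.lt_succ_self)) (h n n.lt_succ_self)

/-- The coefficient of `(z - 1) ^ k` in the monic Jacobi polynomial. -/
noncomputable def jacobiCoeff (α β : ℂ) (n k : ℕ) : ℂ :=
  (n.choose k : ℂ) * (ascPochhammer ℂ (n - k)).eval (α + k + 1)
    / (ascPochhammer ℂ (n - k)).eval (α + β + n + k + 1) * 2 ^ (n - k)

theorem jacobiMonic_comp (α β : ℂ) (n : ℕ) :
    (jacobiMonic α β n).comp (X + C 1) =
      ∑ k ∈ Finset.range (n + 1), C (jacobiCoeff α β n k) * X ^ k := by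
  rw [jacobiMonic, ← coe_compRingHom_apply, map_sum]
  simp only [coe_compRingHom_apply, jacobiCoeff, mul_comp, C_comp, pow_comp,
    sub_comp, X_comp, add_sub_cancel_right]

theorem coeff_jacobiMonic_comp (α β : ℂ) (n k : ℕ) :
    ((jacobiMonic α β n).comp (X + C 1)).coeff k = jacobiCoeff α β n k := by
  rw [jacobiMonic_comp, finsetSum_coeff]
  simp only [coeff_C_mul, coeff_X_pow, mul_ite, mul_one, mul_zero]
  rw [Finset.sum_ite_eq]
  split_ifs with h
  · rfl
  · rw [Finset.mem_range, not_lt] at h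
    simp [jacobiCoeff, Nat.choose_eq_zero_of_lt (Nat.lt_of_succ_le h)]

/-- The translation `z ↦ z + 1` is invertible, and after it the Jacobi coefficients are explicit.
Every Jacobi identity below is checked this way, coefficient by coefficient in powers of `z - 1`. -/
theorem eq_of_comp_coeff {p q : ℂ[X]}
    (h : ∀ k, (p.comp (X + C 1)).coeff k = (q.comp (X + C 1)).coeff k) : p = q := by
  have h1 : p.comp (X + C 1) = q.comp (X + C 1) := Polynomial.ext h
  have h2 := congrArg (fun r : ℂ[X] => r.comp (X - C 1)) h1
  simpa [comp_assoc] using h2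

@[simp] theorem jacobiCoeff_self (α β : ℂ) (n : ℕ) : jacobiCoeff α β n n = 1 := by
  simp [jacobiCoeff]

theorem jacobiCoeff_of_lt {n k : ℕ} (α β : ℂ) (h : n < k) : jacobiCoeff α β n k = 0 := by
  simp [jacobiCoeff, Nat.choose_eq_zero_of_lt h]

@[simp] theorem jacobiMonic_zero (α β : ℂ) : jacobiMonic α β 0 = 1 := by
  simp [jacobiMonic]

theorem degree_X_sub_C_pow (a : ℂ) (n : ℕ) : ((X - C a) ^ n).degree = (n : WithBot ℕ) := by
  simp [degree_pow]

theorem degree_jacobiMonic_sub_lt (α β : ℂ) (n : ℕ) :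
    (jacobiMonic α β n - (X - C 1) ^ n).degree < (n : WithBot ℕ) := by
  have : jacobiMonic α β n - (X - C 1) ^ n =
      ∑ k ∈ Finset.range n, C (jacobiCoeff α β n k) * (X - C 1) ^ k := by
    rw [jacobiMonic, Finset.sum_range_succ]
    simp [jacobiCoeff]
  rw [this]
  refine (degree_sum_le _ _).trans_lt ?_
  refine (Finset.sup_lt_iff (WithBot.bot_lt_coe n)).2 fun k hk => ?_
  rw [degree_mul, degree_X_sub_C_pow]
  refine (add_le_of_nonpos_left degree_C_le).trans_lt ?_
  exact WithBot.coe_lt_coe.2 (Finset.mem_range.1 hk)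

theorem jacobiMonic_monic (α β : ℂ) (n : ℕ) : (jacobiMonic α β n).Monic := by
  have h : jacobiMonic α β n = (X - C 1) ^ n + (jacobiMonic α β n - (X - C 1) ^ n) := by ring
  rw [h]
  refine ((monic_X_sub_C 1).pow n).add_of_left ?_
  rw [degree_X_sub_C_pow]
  exact degree_jacobiMonic_sub_lt α β n

theorem natDegree_jacobiMonic (α β : ℂ) (n : ℕ) : (jacobiMonic α β n).natDegree = n := by
  have h : jacobiMonic α β n = (X - C 1) ^ n + (jacobiMonic α β n - (X - C 1) ^ n) := by ring
  rw [h, natDegree_add_eq_left_of_degree_lt]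
  · exact natDegree_eq_of_degree_eq_some (degree_X_sub_C_pow 1 n)
  · rw [degree_X_sub_C_pow]
    exact degree_jacobiMonic_sub_lt α β n

/-! ### Derivatives, primitives and the polar polynomial -/

/-- Lowering `α`, `β` by one while raising `n`, `k` by one leaves both Pochhammer factors unchanged;
only `(k+1) binom(n+1,k+1) = (n+1) binom(n,k)` remains. The denominators coincide, so even vanishing
ones do no harm. -/
theorem derivative_jacobiMonic_succ (α β : ℂ) (n : ℕ) :
    derivative (jacobiMonic (α - 1) (β - 1) (n + 1)) = C ((n : ℂ) + 1) * jacobiMonic α β n := by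
  refine eq_of_comp_coeff fun k => ?_
  have h : (derivative (jacobiMonic (α - 1) (β - 1) (n + 1))).comp (X + C 1) =
      derivative ((jacobiMonic (α - 1) (β - 1) (n + 1)).comp (X + C 1)) := by
    simp [derivative_comp]
  rw [h, coeff_derivative, coeff_jacobiMonic_comp, mul_comp, C_comp, coeff_C_mul,
    coeff_jacobiMonic_comp, jacobiCoeff, jacobiCoeff]
  have hc : ((n + 1).choose (k + 1) : ℂ) * (k + 1) = (n + 1) * n.choose k := by
    exact_mod_cast (Nat.add_one_mul_choose_eq n k).symm
  have e1 : α - 1 + ((k + 1 : ℕ) : ℂ) + 1 = α + k + 1 := by push_cast; ring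
  have e2 : α - 1 + (β - 1) + ((n + 1 : ℕ) : ℂ) + ((k + 1 : ℕ) : ℂ) + 1 = α + β + n + k + 1 := by
    push_cast; ring
  rw [e1, e2, Nat.add_sub_add_right]
  linear_combination (ascPochhammer ℂ (n - k)).eval (α + k + 1)
    / (ascPochhammer ℂ (n - k)).eval (α + β + n + k + 1) * 2 ^ (n - k) * hc

theorem derivative_polyPrimitive (p : ℂ[X]) : derivative (polyPrimitive p) = p := by
  conv_rhs => rw [p.as_sum_support]
  rw [polyPrimitive, Polynomial.sum, derivative_sum]
  refine Finset.sum_congr rfl fun k _ => ?_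
  rw [derivative_monomial]
  have : (k : ℂ) + 1 ≠ 0 := Nat.cast_add_one_ne_zero k
  congr 1
  push_cast
  field_simp

/-- Two primitives of the same polynomial differ by a constant, which the zero at `ξ` determines. -/
theorem jacobiPrimitive_eq (α β ξ : ℂ) (n : ℕ) :
    jacobiPrimitive α β ξ n = jacobiMonic (α - 1) (β - 1) (n + 1)
      - C ((jacobiMonic (α - 1) (β - 1) (n + 1)).eval ξ) := by
  have hd : derivative (jacobiPrimitive α β ξ n - jacobiMonic (α - 1) (β - 1) (n + 1)) = 0 := by
    rw [derivative_sub, derivative_jacobiMonic_succ, jacobiPrimitive, derivative_C_mul,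
      derivative_sub, derivative_polyPrimitive, derivative_C, sub_zero, sub_self]
  have hC := eq_C_of_derivative_eq_zero hd
  have he := congrArg (eval ξ) hC
  have h0 : (jacobiPrimitive α β ξ n).eval ξ = 0 := by simp [jacobiPrimitive]
  rw [eval_sub, h0, eval_C, zero_sub] at he
  rw [← he, C_neg] at hC
  linear_combination hC

theorem X_sub_C_mul_polarJacobi (α β ξ : ℂ) (n : ℕ) :
    (X - C ξ) * polarJacobi α β ξ n = jacobiMonic (α - 1) (β - 1) (n + 1)
      - C ((jacobiMonic (α - 1) (β - 1) (n + 1)).eval ξ) := by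
  rw [← jacobiPrimitive_eq, polarJacobi]
  exact mul_divByMonic_eq_iff_isRoot.2 (by simp [jacobiPrimitive])

theorem polarOp_polarJacobi (α β ξ : ℂ) (n : ℕ) :
    polarOp ξ (polarJacobi α β ξ n) = C ((n : ℂ) + 1) * jacobiMonic α β n := by
  have h := congrArg derivative (X_sub_C_mul_polarJacobi α β ξ n)
  rw [derivative_sub, derivative_C, derivative_jacobiMonic_succ, derivative_mul,
    derivative_X_sub_C] at h
  rw [polarOp]
  linear_combination h

/-! ### Raising relation and connection formula -/

/-- The operator with `((1 - z ^ 2) p ω)' = (pearsonOp α β p) ω` for the Jacobi weight `ω`. -/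
noncomputable def pearsonOp (α β : ℂ) (p : ℂ[X]) : ℂ[X] :=
  (1 - X ^ 2) * derivative p + (C (β - α) - C (α + β + 2) * X) * p

/-- One step of the Rodrigues formula; it turns orthogonality into repeated integration by parts. -/
theorem pearsonOp_jacobiMonic (α β : ℂ) (hαβ : ∀ k : ℕ, α + β ≠ -((k : ℂ) + 2)) (n : ℕ) :
    pearsonOp α β (jacobiMonic (α + 1) (β + 1) n) =
      -C (α + β + n + 2) * jacobiMonic α β (n + 1) := by
  refine eq_of_comp_coeff fun k => ?_
  set q := (jacobiMonic (α + 1) (β + 1) n).comp (X + C 1) with hq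
  -- With `z = x + 1`, the factor `1 - z²` becomes `-x(x + 2)` and the linear factor becomes `-(2α +
  -- 2) - (α + β + 2)x`.
  have h : (pearsonOp α β (jacobiMonic (α + 1) (β + 1) n)).comp (X + C 1) =
      -(X * (X * derivative q) + C 2 * (X * derivative q) + C (2 * α + 2) * q
        + C (α + β + 2) * (X * q)) := by
    rw [pearsonOp, hq, derivative_comp]
    simp only [add_comp, sub_comp, mul_comp, C_comp, X_comp, one_comp, pow_comp, derivative_add,
      derivative_X, C_1, derivative_one, C_sub, C_add, C_mul]
    have : (C 2 : ℂ[X]) = 2 := rfl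
    rw [this]
    ring
  rw [h, neg_mul, neg_comp, coeff_neg, coeff_neg, mul_comp, C_comp, coeff_C_mul,
    coeff_jacobiMonic_comp]
  congr 1
  have hD : ∀ k, k ≤ n → (ascPochhammer ℂ (n + 1 - k)).eval (α + β + n + k + 2) ≠ 0 := by
    intro k _
    refine ascPochhammer_eval_ne_zero fun j _ hj => hαβ (n + k + j) ?_
    push_cast
    linear_combination hj
  rcases k with _ | k
  · simp only [coeff_add, mul_coeff_zero, coeff_C_zero, coeff_X_zero, zero_mul, mul_zero, zero_add,
      add_zero]
    rw [hq, coeff_jacobiMonic_comp, jacobiCoeff, jacobiCoeff]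
    simp only [Nat.choose_zero_right, Nat.sub_zero, Nat.cast_zero, Nat.cast_one, one_mul, add_zero]
    have h0 := hD 0 n.zero_le
    simp only [Nat.cast_zero, Nat.sub_zero, add_zero] at h0
    have e1 : α + β + ((n + 1 : ℕ) : ℂ) + 1 = α + β + n + 2 := by push_cast; ring
    have e2 : α + 1 + (β + 1) + (n : ℂ) + 1 = α + β + n + 2 + 1 := by ring
    rw [e1, e2, ascPochhammer_succ_eval_left n (α + 1)]
    rw [ascPochhammer_succ_eval_left] at h0 ⊢
    have h1 := left_ne_zero_of_mul h0
    have h2 := right_ne_zero_of_mul h0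
    field_simp
    ring
  · simp only [coeff_add, coeff_C_mul, coeff_X_mul, coeff_derivative]
    have hX : (X * derivative q).coeff k = k * q.coeff k := by
      rcases k with _ | k
      · simp
      · rw [coeff_X_mul, coeff_derivative]; push_cast; ring
    rw [hX, hq, coeff_jacobiMonic_comp, coeff_jacobiMonic_comp]
    rcases lt_trichotomy n k with hk | rfl | hk
    · rw [jacobiCoeff_of_lt _ _ hk, jacobiCoeff_of_lt _ _ (hk.trans k.lt_succ_self),
        jacobiCoeff_of_lt _ _ (Nat.succ_lt_succ hk)]
      simp
    · rw [jacobiCoeff_of_lt _ _ n.lt_succ_self, jacobiCoeff_self, jacobiCoeff_self]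
      ring
    · obtain ⟨j, rfl⟩ := Nat.exists_eq_add_of_lt hk
      have h0 := hD (k + 1) hk
      simp only [jacobiCoeff]
      have s1 : k + j + 1 + 1 - (k + 1) = j + 1 := by omega
      have s2 : k + j + 1 - k = j + 1 := by omega
      have s3 : k + j + 1 - (k + 1) = j := by omega
      rw [s1] at h0 ⊢
      rw [s2, s3]
      -- All Pochhammer symbols reduce to `(x + 1)_j` and `(y + 1)_j`, up to the first factors `x`
      -- and `y`. Eliminating `α` and `β` leaves a rational identity modulo the binomial relation
      -- `hc2`.
      set x : ℂ := α + k + 2 with hx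
      set y : ℂ := α + β + ((k + j + 1 : ℕ) : ℂ) + ((k + 1 : ℕ) : ℂ) + 2 with hy
      have a1 : α + 1 + (k : ℂ) + 1 = x := by rw [hx]; ring
      have a2 : α + 1 + ((k + 1 : ℕ) : ℂ) + 1 = x + 1 := by rw [hx]; push_cast; ring
      have a3 : α + ((k + 1 : ℕ) : ℂ) + 1 = x := by rw [hx]; push_cast; ring
      have b1 : α + 1 + (β + 1) + ((k + j + 1 : ℕ) : ℂ) + k + 1 = y := by
        rw [hy]; push_cast; ring
      have b2 : α + 1 + (β + 1) + ((k + j + 1 : ℕ) : ℂ) + ((k + 1 : ℕ) : ℂ) + 1 = y + 1 := by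
        rw [hy]; push_cast; ring
      have b3 : α + β + ((k + j + 1 + 1 : ℕ) : ℂ) + ((k + 1 : ℕ) : ℂ) + 1 = y := by
        rw [hy]; push_cast; ring
      rw [a1, a2, a3, b1, b2, b3, ascPochhammer_succ_eval_left j x]
      rw [ascPochhammer_succ_eval_left] at h0 ⊢
      have h1 := left_ne_zero_of_mul h0
      have h2 := right_ne_zero_of_mul h0
      have hc1 : ((k + j + 1 + 1).choose (k + 1) : ℂ) =
          (k + j + 1).choose k + (k + j + 1).choose (k + 1) := by
        exact_mod_cast Nat.choose_succ_succ (k + j + 1) k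
      have hc2 : ((k + j + 1).choose (k + 1) : ℂ) * (k + 1) = (k + j + 1).choose k * (j + 1) := by
        have := Nat.choose_succ_right_eq (k + j + 1) k
        rw [s2] at this
        exact_mod_cast this
      rw [hc1]
      have hα : α = x - k - 2 := by rw [hx]; ring
      have hβ : β = y - x - 2 * k - j - 2 + k + 2 - 2 - 1 + 1 - k + k := by
        rw [hy, hx]; push_cast; ring
      generalize (ascPochhammer ℂ j).eval (x + 1) = A
      generalize (ascPochhammer ℂ j).eval (y + 1) = E at h2 ⊢
      clear_value x y
      subst hα
      subst hβ
      field_simp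
      push_cast
      linear_combination (2 * A * x * 2 ^ j : ℂ) * hc2

theorem pearsonOp_mul (α β : ℂ) (p q : ℂ[X]) :
    pearsonOp α β (p * q) = pearsonOp α β p * q + (1 - X ^ 2) * (p * derivative q) := by
  rw [pearsonOp, pearsonOp, derivative_mul]
  ring

theorem jacobiMonic_sub_one_eq (α β : ℂ) (hαβ : ∀ k : ℕ, α + β ≠ -((k : ℂ) + 2)) (n : ℕ)
    (hn : 1 < n) :
    jacobiMonic (α - 1) (β - 1) (n + 1) = jacobiMonic α β (n + 1)
      + C (betaTilde α β n) * jacobiMonic α β n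
      + C (gammaTilde α β n) * jacobiMonic α β (n - 1) := by
  -- This is where `n > 1` enters: the denominators start at `α + β + n`, which the hypothesis on `α
  -- + β` keeps nonzero only from `n = 2` on.
  have hs : ∀ k : ℕ, α + β + n + k ≠ 0 := fun k hk => hαβ (n - 2 + k) (by
    have : ((n - 2 : ℕ) : ℂ) = n - 2 := by
      rw [Nat.cast_sub hn]; norm_num
    push_cast
    rw [this]
    linear_combination hk)
  have hs0 : α + β + 2 * n ≠ 0 := fun h => hs n (by linear_combination h)
  have hs2 : α + β + 2 * n + 2 ≠ 0 := fun h => hs (n + 2) (by push_cast; linear_combination h)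
  have hs1 : α + β + 2 * n + 1 ≠ 0 := fun h => hs (n + 1) (by push_cast; linear_combination h)
  have hsm : α + β + 2 * n - 1 ≠ 0 := fun h => hs (n - 1) (by
    have : ((n - 1 : ℕ) : ℂ) = n - 1 := by rw [Nat.cast_sub hn.le]; norm_num
    rw [this]; linear_combination h)
  refine eq_of_comp_coeff fun k => ?_
  simp only [add_comp, mul_comp, C_comp, coeff_add, coeff_C_mul, coeff_jacobiMonic_comp]
  rcases lt_trichotomy n k with hk | rfl | hk
  · rw [jacobiCoeff_of_lt α β hk, jacobiCoeff_of_lt α β (by omega : n - 1 < k)]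
    rcases eq_or_lt_of_le (Nat.succ_le_of_lt hk) with rfl | hk'
    · simp
    · rw [jacobiCoeff_of_lt α β hk', jacobiCoeff_of_lt _ _ hk']
      simp
  · rw [jacobiCoeff_of_lt α β (by omega : n - 1 < n), jacobiCoeff_self, jacobiCoeff, jacobiCoeff,
      betaTilde]
    simp only [Nat.add_sub_cancel_left, ascPochhammer_one, eval_X, Nat.choose_succ_self_right]
    push_cast
    have h1 : α - 1 + (β - 1) + ((n : ℂ) + 1) + n + 1 = α + β + 2 * n := by ring
    have h2 : α + β + ((n : ℂ) + 1) + n + 1 = α + β + 2 * n + 2 := by ring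
    rw [h1, h2]
    obtain ⟨d, hd⟩ : ∃ d, d = α + β + 2 * (n : ℂ) := ⟨_, rfl⟩
    obtain rfl : β = d - α - 2 * n := by rw [hd]; ring
    rw [← hd] at hs0 hs2 ⊢
    field_simp
    ring
  · obtain ⟨j, rfl⟩ := Nat.exists_eq_add_of_lt hk
    simp only [jacobiCoeff]
    have s1 : k + j + 1 + 1 - k = j + 2 := by omega
    have s2 : k + j + 1 - k = j + 1 := by omega
    have s3 : k + j + 1 - 1 - k = j := by omega
    have s4 : k + j + 1 - 1 = k + j := by omega
    rw [s1, s2, s3, s4, betaTilde, gammaTilde]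
    set y : ℂ := α + β + ((k + j + 1 : ℕ) : ℂ) + k with hy
    have hN : ((k + j + 1 : ℕ) : ℂ) = k + j + 1 := by push_cast; ring
    have hE : (ascPochhammer ℂ j).eval y ≠ 0 := by
      refine ascPochhammer_eval_ne_zero fun i _ hi => hs (k + i) ?_
      push_cast at hi ⊢
      rw [hy] at hi
      push_cast at hi
      linear_combination hi
    have hy0 : y ≠ 0 := hs k
    have hy1 : y + 1 ≠ 0 := fun h => hs (k + 1) (by push_cast; rw [hy] at h; push_cast at h; linear_combination h)
    have b1 : α - 1 + (β - 1) + ((k + j + 1 + 1 : ℕ) : ℂ) + k + 1 = y := by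
      rw [hy]; push_cast; ring
    have b2 : α + β + ((k + j + 1 + 1 : ℕ) : ℂ) + k + 1 = y + 1 + 1 := by
      rw [hy]; push_cast; ring
    have b3 : α + β + ((k + j + 1 : ℕ) : ℂ) + k + 1 = y + 1 := by rw [hy]
    have b4 : α + β + ((k + j : ℕ) : ℂ) + k + 1 = y := by rw [hy]; push_cast; ring
    have a1 : α - 1 + (k : ℂ) + 1 = α + k := by ring
    rw [b1, b2, b3, b4, a1]
    -- Numerators are written through `A = (α + k + 1)_j` and denominators through `E = (y)_j`; the
    -- shifted symbols come from splitting `(y)_{j+2}` and `(y)_{j+4}` at either end. The binomials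
    -- likewise reduce to a single one, and a rational identity remains.
    set A := (ascPochhammer ℂ j).eval (α + k + 1) with hA
    set E := (ascPochhammer ℂ j).eval y with hEd
    have p1 : (ascPochhammer ℂ (j + 2)).eval (α + k) = (α + k) * (A * (α + k + 1 + j)) := by
      rw [ascPochhammer_succ_eval_left, ascPochhammer_succ_eval]
    have p2 : (ascPochhammer ℂ (j + 2)).eval (α + k + 1) =
        A * (α + k + 1 + j) * (α + k + 1 + j + 1) := by
      rw [ascPochhammer_succ_eval, ascPochhammer_succ_eval]; push_cast; ring
    have p3 : (ascPochhammer ℂ (j + 1)).eval (α + k + 1) = A * (α + k + 1 + j) :=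
      ascPochhammer_succ_eval _ _
    have q1 : (ascPochhammer ℂ (j + 2)).eval y = E * (y + j) * (y + j + 1) := by
      rw [ascPochhammer_succ_eval, ascPochhammer_succ_eval]; push_cast; ring
    have q2 : (ascPochhammer ℂ (j + 1)).eval (y + 1) = E * (y + j) * (y + j + 1) / y := by
      rw [eq_div_iff hy0, ← q1, ascPochhammer_succ_eval_left (j + 1)]; ring
    have q3 : (ascPochhammer ℂ (j + 2)).eval (y + 1 + 1) =
        E * (y + j) * (y + j + 1) * (y + j + 2) * (y + j + 3) / (y * (y + 1)) := by
      rw [eq_div_iff (mul_ne_zero hy0 hy1)]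
      have h4 : (ascPochhammer ℂ (j + 4)).eval y =
          y * ((y + 1) * (ascPochhammer ℂ (j + 2)).eval (y + 1 + 1)) := by
        rw [ascPochhammer_succ_eval_left, ascPochhammer_succ_eval_left]
      rw [ascPochhammer_succ_eval, ascPochhammer_succ_eval, q1] at h4
      push_cast at h4
      linear_combination -h4
    have hj1 : (j : ℂ) + 1 ≠ 0 := Nat.cast_add_one_ne_zero j
    have hj2 : (j : ℂ) + 2 ≠ 0 := by exact_mod_cast (Nat.succ_ne_zero (j + 1))
    have c1 : ((k + j + 1).choose k : ℂ) = (k + j + 1) * ((k + j).choose k : ℂ) / (j + 1) := by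
      rw [eq_div_iff hj1]
      have := Nat.choose_mul_succ_eq (k + j) k
      rw [s2] at this
      exact_mod_cast (this.symm.trans (mul_comm _ _))
    have c2 : ((k + j + 1 + 1).choose k : ℂ) =
        (k + j + 2) * ((k + j + 1).choose k : ℂ) / (j + 2) := by
      rw [eq_div_iff hj2]
      have := Nat.choose_mul_succ_eq (k + j + 1) k
      rw [s1] at this
      exact_mod_cast (this.symm.trans (mul_comm _ _))
    rw [p1, p2, p3, q1, q2, q3, c2, c1, hN]
    have hβ : β = y - α - 2 * k - j - 1 := by rw [hy, hN]; ring
    rw [hN] at hs0 hs1 hs2 hsm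
    have d0 : α + β + 2 * ((k : ℂ) + j + 1) = y + j + 1 := by rw [hβ]; ring
    have d1 : α + β + 2 * ((k : ℂ) + j + 1) + 1 = y + j + 2 := by rw [hβ]; ring
    have d2 : α + β + 2 * ((k : ℂ) + j + 1) + 2 = y + j + 3 := by rw [hβ]; ring
    have dm : α + β + 2 * ((k : ℂ) + j + 1) - 1 = y + j := by rw [hβ]; ring
    rw [d0] at hs0
    rw [d1] at hs1
    rw [d2] at hs2
    rw [dm] at hsm
    rw [d2, d1, dm, d0, hβ]
    clear_value A E y
    clear p1 p2 p3 q1 q2 q3 c1 c2 hs b1 b2 b3 b4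
    field_simp
    ring

/-! ### Continuous logarithms along a curve -/

/-- By continuity the imaginary part of `u s - u t` stays below `π` in absolute value near `t`, so
there `u s = u t + log (p s / p t)` with the principal logarithm. -/
theorem hasDerivAt_of_exp_eq {u p : ℝ → ℂ} {p' : ℂ} {t : ℝ} (hu : ContinuousAt u t)
    (h : ∀ᶠ s in nhds t, Complex.exp (u s) = p s) (hp : HasDerivAt p p' t) :
    HasDerivAt u (p' / p t) t := by
  have ht := h.self_of_nhds
  have hne : p t ≠ 0 := ht ▸ Complex.exp_ne_zero _
  have hv : HasDerivAt (fun s => u t + Complex.log (p s / p t)) (p' / p t) t := by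
    have h1 := (hp.div_const (p t)).clog_real (by rw [div_self hne]; exact Complex.one_mem_slitPlane)
    rw [div_self hne, div_one] at h1
    exact h1.const_add (u t)
  refine hv.congr_of_eventuallyEq ?_
  have hlim : Filter.Tendsto (fun s => ‖u s - u t‖) (nhds t) (nhds 0) := by
    have := (hu.sub (continuousAt_const (y := u t))).norm
    simpa [ContinuousAt] using this
  filter_upwards [h, hlim.eventually_lt_const Real.pi_pos] with s hs hlt
  have him := (Complex.abs_im_le_norm (u s - u t)).trans_lt hlt
  rw [abs_lt] at him
  rw [← hs, ← ht, ← Complex.exp_sub, Complex.log_exp him.1 him.2.le]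
  ring

/-- The difference of two continuous logarithms has derivative zero off a countable set, hence is
constant; its value is read off at `a`. -/
theorem eq_log_add_of_exp_eq {a b c : ℝ} {v q : ℝ → ℂ} {S : Set ℝ} (hS : S.Countable)
    (hq : ContinuousOn q (Set.Icc a b)) (hq' : ∀ t ∈ Set.Ioo a b \ S, DifferentiableAt ℝ q t)
    (hv : ContinuousOn v (Set.Icc a b)) (hexp : ∀ t ∈ Set.Icc a b, Complex.exp (v t) = q t)
    (hslit : ∀ t ∈ Set.Icc a b, q t ∈ Complex.slitPlane) (hc : Complex.exp (c * Complex.I) = 1)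
    (hva : (v a).im = c) {t : ℝ} (ht : t ∈ Set.Icc a b) :
    v t = Complex.log (q t) + c * Complex.I := by
  have ha : v a = Complex.log (q a) + c * Complex.I := by
    rw [← hexp a ⟨le_rfl, ht.1.trans ht.2⟩]
    have h1 : Complex.exp (v a) = Complex.exp (v a - c * Complex.I) := by
      rw [Complex.exp_sub, hc, div_one]
    have h2 : (v a - c * Complex.I).im = 0 := by simp [hva]
    rw [h1, Complex.log_exp (by rw [h2]; linarith [Real.pi_pos]) (by rw [h2]; exact Real.pi_pos.le)]
    ring
  have hsub : Set.Icc a t ⊆ Set.Icc a b := Set.Icc_subset_Icc_right ht.2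
  have key := MeasureTheory.integral_eq_of_hasDerivAt_off_countable_of_le
    (fun t => v t - Complex.log (q t)) (fun _ => 0) ht.1 hS
    ((hv.mono hsub).sub ((hq.mono hsub).clog fun x hx => hslit x (hsub hx)))
    (fun x hx => by
      have hx' : x ∈ Set.Ioo a b := ⟨hx.1.1, hx.1.2.trans_le ht.2⟩
      have hnhds : Set.Icc a b ∈ nhds x := Icc_mem_nhds hx'.1 hx'.2
      have hd := (hq' x ⟨hx', hx.2⟩).hasDerivAt
      have h1 := hasDerivAt_of_exp_eq (hv.continuousAt hnhds)
        (Filter.mem_of_superset hnhds hexp) hd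
      have h2 := hd.clog_real (hslit x (Set.Ioo_subset_Icc_self hx'))
      exact (h1.sub h2).congr_deriv (sub_self _))
    (by simp)
  rw [intervalIntegral.integral_zero, ha] at key
  linear_combination -key

/-! ### The Euler integral as a primitive of the weight -/

theorem segment_two_mem_slitPlane {w : ℂ} (hw : w ∈ Complex.slitPlane) {s : ℝ}
    (hs : s ∈ Set.Icc (0 : ℝ) 1) : 2 * (1 - (s : ℂ)) + w * s ∈ Complex.slitPlane := by
  have := Complex.starConvex_ofReal_slitPlane (x := 2) two_pos hw (sub_nonneg.2 hs.2) hs.1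
    (by ring)
  simp only [Complex.real_smul] at this
  convert this using 1
  push_cast
  ring

/-- The Euler integral `∫₀¹ s ^ α (2 (1 - s) + w s) ^ β ds`. -/
noncomputable def eulerIntegral (α β w : ℂ) : ℂ :=
  ∫ s in (0 : ℝ)..1, (s : ℂ) ^ α * (2 * (1 - (s : ℂ)) + w * s) ^ β

theorem continuousOn_segment_cpow (β : ℂ) :
    ContinuousOn (fun x : ℂ × ℝ => (2 * (1 - (x.2 : ℂ)) + x.1 * x.2) ^ β)
      (Complex.slitPlane ×ˢ Set.Icc (0 : ℝ) 1) := by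
  refine ContinuousOn.cpow (by fun_prop) continuousOn_const fun x hx => ?_
  exact segment_two_mem_slitPlane hx.1 hx.2

/-- Differentiation under the integral sign. Since `Re α > 0`, the factor `s ^ α` is continuous at
`0`, so compactness bounds the derivative uniformly for `w` in a small closed ball. -/
theorem hasDerivAt_eulerIntegral {α w : ℂ} (β : ℂ) (hα : 0 < α.re) (hw : w ∈ Complex.slitPlane) :
    HasDerivAt (eulerIntegral α β) (∫ s in (0 : ℝ)..1,
      (s : ℂ) ^ α * (s * (β * (2 * (1 - (s : ℂ)) + w * s) ^ (β - 1)))) w := by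
  obtain ⟨ε, hε, hball⟩ := Metric.nhds_basis_closedBall.mem_iff.1
    (Complex.isOpen_slitPlane.mem_nhds hw)
  have hpow : Continuous fun s : ℝ => (s : ℂ) ^ α := Complex.continuous_ofReal_cpow_const hα
  have hcont : ContinuousOn (fun x : ℂ × ℝ =>
      (x.2 : ℂ) ^ α * (x.2 * (β * (2 * (1 - (x.2 : ℂ)) + x.1 * x.2) ^ (β - 1))))
      (Metric.closedBall w ε ×ˢ Set.Icc (0 : ℝ) 1) := by
    have h1 := (continuousOn_segment_cpow (β - 1)).mono (Set.prod_mono_left hball)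
    have h2 : Continuous fun x : ℂ × ℝ => (x.2 : ℂ) ^ α := hpow.comp continuous_snd
    have h3 : Continuous fun x : ℂ × ℝ => (x.2 : ℂ) := by fun_prop
    exact h2.continuousOn.mul (h3.continuousOn.mul (continuousOn_const.mul h1))
  obtain ⟨M, hM⟩ := ((isCompact_closedBall w ε).prod isCompact_Icc).exists_bound_of_continuousOn
    hcont
  have hslice : ∀ β' : ℂ, ∀ x ∈ Complex.slitPlane,
      ContinuousOn (fun s : ℝ => (2 * (1 - (s : ℂ)) + x * s) ^ β') (Set.Icc 0 1) := fun β' x hx =>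
    (continuousOn_segment_cpow β').comp (f := fun s : ℝ => (x, s)) (by fun_prop)
      fun s hs => ⟨hx, hs⟩
  have hF : ∀ x ∈ Complex.slitPlane, ContinuousOn
      (fun s : ℝ => (s : ℂ) ^ α * (2 * (1 - (s : ℂ)) + x * s) ^ β) (Set.uIcc 0 1) := by
    intro x hx
    rw [Set.uIcc_of_le zero_le_one]
    exact hpow.continuousOn.mul (hslice β x hx)
  have hIoc : Set.uIoc (0 : ℝ) 1 ⊆ Set.Icc 0 1 := by
    rw [Set.uIoc_of_le zero_le_one]; exact Set.Ioc_subset_Icc_self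
  refine (intervalIntegral.hasDerivAt_integral_of_dominated_loc_of_deriv_le
    (F' := fun (x : ℂ) (s : ℝ) =>
      (s : ℂ) ^ α * (s * (β * (2 * (1 - (s : ℂ)) + x * s) ^ (β - 1)))) (bound := fun _ => M)
    (Metric.closedBall_mem_nhds w hε) ?_ ((hF w hw).intervalIntegrable) ?_ ?_ (by simp) ?_).2
  · filter_upwards [Complex.isOpen_slitPlane.mem_nhds hw] with x hx
    exact ((hF x hx).mono Set.uIoc_subset_uIcc).aestronglyMeasurable measurableSet_uIoc
  · refine ContinuousOn.aestronglyMeasurable ?_ measurableSet_uIoc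
    have h3 : Continuous fun s : ℝ => (s : ℂ) := by fun_prop
    exact (hpow.continuousOn.mul (h3.continuousOn.mul
      (continuousOn_const.mul (hslice (β - 1) w hw)))).mono hIoc
  · exact Filter.Eventually.of_forall fun s hs x hx => hM (x, s) ⟨hx, hIoc hs⟩
  · refine Filter.Eventually.of_forall fun s hs x hx => ?_
    have h1 : HasDerivAt (fun x : ℂ => 2 * (1 - (s : ℂ)) + x * s) s x := by
      simpa using ((hasDerivAt_id x).mul_const (s : ℂ)).const_add (2 * (1 - (s : ℂ)))
    have h2 := (h1.cpow_const (c := β)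
      (segment_two_mem_slitPlane (hball hx) (hIoc hs))).const_mul ((s : ℂ) ^ α)
    refine h2.congr_deriv ?_
    ring

/-- The left side integrates the derivative of `s^{α+1} (2(1-s) + ws)^β` over `[0, 1]`. For `w = 1 +
z` the equation says that `-(1-z)^{α+1} eulerIntegral α β (1+z)` is a primitive of `(1-z)^α
(1+z)^β`. -/
theorem eulerIntegral_ode {α w : ℂ} (β : ℂ) (hα : 0 < α.re) (hw : w ∈ Complex.slitPlane) :
    (α + 1) * eulerIntegral α β w + (w - 2) * (∫ s in (0 : ℝ)..1,
      (s : ℂ) ^ α * (s * (β * (2 * (1 - (s : ℂ)) + w * s) ^ (β - 1)))) = w ^ β := by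
  have hpow : Continuous fun s : ℝ => (s : ℂ) ^ α := Complex.continuous_ofReal_cpow_const hα
  have hs1 : Continuous fun s : ℝ => (s : ℂ) := by fun_prop
  have hslice : ∀ β' : ℂ,
      ContinuousOn (fun s : ℝ => (2 * (1 - (s : ℂ)) + w * s) ^ β') (Set.Icc 0 1) := fun β' =>
    (continuousOn_segment_cpow β').comp (f := fun s : ℝ => (w, s)) (by fun_prop)
      fun s hs => ⟨hw, hs⟩
  have hα1 : α + 1 ≠ 0 := fun h => by
    have := congrArg Complex.re h
    simp at this
    linarith
  have i1 : IntervalIntegrable (fun s : ℝ => (s : ℂ) ^ α * (2 * (1 - (s : ℂ)) + w * s) ^ β)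
      MeasureTheory.volume 0 1 :=
    ContinuousOn.intervalIntegrable (by
      rw [Set.uIcc_of_le zero_le_one]; exact hpow.continuousOn.mul (hslice β))
  have i2 : IntervalIntegrable (fun s : ℝ => (s : ℂ) ^ α *
      (s * (β * (2 * (1 - (s : ℂ)) + w * s) ^ (β - 1)))) MeasureTheory.volume 0 1 :=
    ContinuousOn.intervalIntegrable (by
      rw [Set.uIcc_of_le zero_le_one]
      exact hpow.continuousOn.mul (hs1.continuousOn.mul (continuousOn_const.mul (hslice (β - 1)))))
  have key := intervalIntegral.integral_eq_sub_of_hasDerivAt_of_le zero_le_one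
    (f := fun s : ℝ => (s : ℂ) ^ (α + 1) * (2 * (1 - (s : ℂ)) + w * s) ^ β)
    (f' := fun s : ℝ => (α + 1) * ((s : ℂ) ^ α * (2 * (1 - (s : ℂ)) + w * s) ^ β) + (w - 2) *
      ((s : ℂ) ^ α * (s * (β * (2 * (1 - (s : ℂ)) + w * s) ^ (β - 1)))))
    ((Complex.continuous_ofReal_cpow_const (by simp; linarith)).continuousOn.mul (hslice β))
    (fun s hs => by
      have hs0 : (s : ℂ) ≠ 0 := Complex.ofReal_ne_zero.2 hs.1.ne'
      have h1 : HasDerivAt (fun s : ℝ => (s : ℂ) ^ (α + 1)) ((s : ℂ) ^ α * (α + 1)) s := by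
        refine (hasDerivAt_ofReal_cpow_const hs.1.ne' hα1).congr_deriv ?_
        rw [add_sub_cancel_right, mul_comm]
      have h2 : HasDerivAt (fun s : ℝ => 2 * (1 - (s : ℂ)) + w * s) (w - 2) s := by
        have h3 : HasDerivAt (fun s : ℝ => (s : ℂ)) 1 s := Complex.ofRealCLM.hasDerivAt
        refine (((h3.const_sub 1).const_mul 2).add (h3.const_mul w)).congr_deriv ?_
        ring
      have h4 := (hasDerivAt_id _).cpow_const (c := β)
        (segment_two_mem_slitPlane hw (Set.Ioo_subset_Icc_self hs))
      have h5 := h1.mul (HasDerivAt.comp s h4 h2)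
      refine h5.congr_deriv ?_
      simp only [id, Function.comp_apply]
      rw [Complex.cpow_add _ _ hs0, Complex.cpow_one]
      ring)
    ((i1.const_mul _).add (i2.const_mul _))
  rw [intervalIntegral.integral_add (i1.const_mul _) (i2.const_mul _),
    intervalIntegral.integral_const_mul, intervalIntegral.integral_const_mul] at key
  rw [eulerIntegral, key]
  simp [Complex.zero_cpow hα1]

/-- The integral of a branch of the Jacobi weight along a curve that does not meet `(-∞, -1]`. -/
theorem integral_jacobi_branch {α : ℂ} (β : ℂ) (hα : 0 < α.re) {a b : ℝ} (hab : a ≤ b)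
    {z u : ℝ → ℂ} {S : Set ℝ} (hS : S.Countable) (hz : ContinuousOn z (Set.Icc a b))
    (hz' : ∀ t ∈ Set.Ioo a b \ S, DifferentiableAt ℝ z t)
    (hint : IntervalIntegrable (deriv z) MeasureTheory.volume a b)
    (hu : ContinuousOn u (Set.Icc a b)) (hexp : ∀ t ∈ Set.Icc a b, Complex.exp (u t) = 1 - z t)
    (hslit : ∀ t ∈ Set.Icc a b, 1 + z t ∈ Complex.slitPlane) :
    ∫ t in a..b, Complex.exp (α * u t) * (1 + z t) ^ β * deriv z t =
      Complex.exp ((α + 1) * u a) * eulerIntegral α β (1 + z a)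
        - Complex.exp ((α + 1) * u b) * eulerIntegral α β (1 + z b) := by
  have hE : ContinuousOn (eulerIntegral α β) Complex.slitPlane := fun w hw =>
    (hasDerivAt_eulerIntegral β hα hw).continuousAt.continuousWithinAt
  have hexpc : ∀ c : ℂ, ContinuousOn (fun t => Complex.exp (c * u t)) (Set.Icc a b) := fun c =>
    (continuousOn_const.mul hu).cexp
  have h1z : ContinuousOn (fun t => 1 + z t) (Set.Icc a b) := continuousOn_const.add hz
  -- In the primitive, `(1-z)^{α+1}` is replaced by `exp((α+1)u)`, so the curve may wind around
  -- `+1`.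
  have key := MeasureTheory.integral_eq_of_hasDerivAt_off_countable_of_le
    (fun t => -(Complex.exp ((α + 1) * u t) * eulerIntegral α β (1 + z t)))
    (fun t => Complex.exp (α * u t) * (1 + z t) ^ β * deriv z t) hab hS
    ((hexpc _).mul (hE.comp h1z hslit)).neg
    (fun t ht => by
      have htI := Set.Ioo_subset_Icc_self ht.1
      have hnhds : Set.Icc a b ∈ nhds t := Icc_mem_nhds ht.1.1 ht.1.2
      have hd := (hz' t ht).hasDerivAt
      have h1 := hasDerivAt_of_exp_eq (hu.continuousAt hnhds)
        (Filter.mem_of_superset hnhds hexp) (hd.const_sub 1)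
      have h2 := (h1.const_mul (α + 1)).cexp
      have h3 := HasDerivAt.comp t (hasDerivAt_eulerIntegral β hα (hslit t htI)) (hd.const_add 1)
      have ho := eulerIntegral_ode β hα (hslit t htI)
      generalize (∫ s in (0 : ℝ)..1, (s : ℂ) ^ α *
        (s * (β * (2 * (1 - (s : ℂ)) + (1 + z t) * s) ^ (β - 1)))) = J at h3 ho
      have hne : 1 - z t ≠ 0 := hexp t htI ▸ Complex.exp_ne_zero _
      have he : Complex.exp ((α + 1) * u t) = Complex.exp (α * u t) * (1 - z t) := by
        rw [← hexp t htI, ← Complex.exp_add]; ring_nf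
      refine ((h2.mul h3).neg).congr_deriv ?_
      rw [← ho, he, Function.comp_apply]
      field_simp
      ring)
    (hint.continuousOn_mul (by
      rw [Set.uIcc_of_le hab]
      exact (hexpc α).mul (h1z.cpow continuousOn_const hslit)))
  rw [key]
  ring

theorem exp_log_mul_eulerIntegral (α β : ℂ) {x : ℝ} (hx : x < 1) :
    Complex.exp ((α + 1) * Complex.log (1 - x)) * eulerIntegral α β (1 + x) =
      ∫ y in x..1, (1 - (y : ℂ)) ^ α * (1 + (y : ℂ)) ^ β := by
  have hc : (1 - x : ℝ) ≠ 0 := (sub_pos.2 hx).ne'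
  have hcc : (1 - x : ℂ) ≠ 0 := by exact_mod_cast hc
  -- Substitution `y = 1 - (1-x)s`, for which `1 + y = 2(1-s) + (1+x)s`.
  have h := intervalIntegral.integral_comp_sub_mul (a := 0) (b := 1)
    (fun y : ℝ => (1 - (y : ℂ)) ^ α * (1 + (y : ℂ)) ^ β) hc 1
  rw [mul_one, mul_zero, sub_zero, sub_sub_cancel, Complex.real_smul] at h
  have hpow : Complex.exp ((α + 1) * Complex.log (1 - x)) = (1 - x : ℂ) * (1 - x : ℂ) ^ α := by
    rw [mul_comm (α + 1), ← Complex.cpow_def_of_ne_zero hcc, Complex.cpow_add _ _ hcc,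
      Complex.cpow_one, mul_comm]
  have h2 : (∫ s in (0 : ℝ)..1, (1 - ((1 - (1 - x) * s : ℝ) : ℂ)) ^ α *
      (1 + ((1 - (1 - x) * s : ℝ) : ℂ)) ^ β) = (1 - x : ℂ) ^ α * eulerIntegral α β (1 + x) := by
    rw [eulerIntegral, ← intervalIntegral.integral_const_mul]
    refine intervalIntegral.integral_congr fun s hs => ?_
    rw [Set.uIcc_of_le zero_le_one] at hs
    have e1 : (1 - ((1 - (1 - x) * s : ℝ) : ℂ)) = ((1 - x : ℝ) : ℂ) * (s : ℂ) := by
      push_cast; ring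
    have e2 : (1 + ((1 - (1 - x) * s : ℝ) : ℂ)) = 2 * (1 - (s : ℂ)) + (1 + x) * s := by
      push_cast; ring
    rw [e1, e2, Complex.mul_cpow_ofReal_nonneg (sub_pos.2 hx).le hs.1]
    push_cast
    ring
  rw [h2] at h
  rw [hpow, mul_assoc, h]
  push_cast
  field_simp

/-- The two terms are the integrals of the real-branch weight over `[x, 1]` and `[-1, x]`, so they
add up to a complete beta integral, independent of `x`. This independence lets the boundary terms of
consecutive circuits combine. -/
theorem exp_log_mul_eulerIntegral_add {α β : ℂ} (hα : 0 < α.re) (hβ : 0 < β.re) {x : ℝ}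
    (hx : -1 < x) (hx' : x < 1) :
    Complex.exp ((α + 1) * Complex.log (1 - x)) * eulerIntegral α β (1 + x)
      + Complex.exp ((β + 1) * Complex.log (1 + x)) * eulerIntegral β α (1 - x) =
      2 ^ (α + β + 1) * (Complex.Gamma (α + 1) * Complex.Gamma (β + 1)
        / Complex.Gamma (α + β + 2)) := by
  have h2 := exp_log_mul_eulerIntegral β α (x := -x) (by linarith)
  simp only [Complex.ofReal_neg, sub_neg_eq_add, ← sub_eq_add_neg] at h2
  rw [exp_log_mul_eulerIntegral α β hx', h2]
  have h3 : (∫ y in (-x)..1, (1 - (y : ℂ)) ^ β * (1 + (y : ℂ)) ^ α) =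
      ∫ y in (-1)..x, (1 - (y : ℂ)) ^ α * (1 + (y : ℂ)) ^ β := by
    have := intervalIntegral.integral_comp_neg (a := -1) (b := x)
      (fun y : ℝ => (1 - (y : ℂ)) ^ β * (1 + (y : ℂ)) ^ α)
    rw [neg_neg] at this
    rw [← this]
    refine intervalIntegral.integral_congr fun y _ => ?_
    simp only [Complex.ofReal_neg, sub_neg_eq_add, ← sub_eq_add_neg]
    ring
  have hcont : Continuous fun y : ℝ => (1 - (y : ℂ)) ^ α * (1 + (y : ℂ)) ^ β := by
    have c1 : Continuous fun y : ℝ => (1 - (y : ℂ)) ^ α := by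
      have := (Complex.continuous_ofReal_cpow_const hα).comp (continuous_sub_left (1 : ℝ))
      simpa [Function.comp_def] using this
    have c2 : Continuous fun y : ℝ => (1 + (y : ℂ)) ^ β := by
      have := (Complex.continuous_ofReal_cpow_const hβ).comp (continuous_const_add (1 : ℝ))
      simpa [Function.comp_def] using this
    exact c1.mul c2
  rw [h3, add_comm, intervalIntegral.integral_add_adjacent_intervals
    (hcont.intervalIntegrable _ _) (hcont.intervalIntegrable _ _)]
  have h4 := Complex.betaIntegral_scaled (β + 1) (α + 1) (two_pos : (0 : ℝ) < 2)
  have h5 := intervalIntegral.integral_comp_add_left (a := -1) (b := 1)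
    (fun y : ℝ => (y : ℂ) ^ (β + 1 - 1) * (((2 : ℝ) : ℂ) - y) ^ (α + 1 - 1)) 1
  norm_num at h5
  have h6 : (∫ y in (-1 : ℝ)..1, (1 - (y : ℂ)) ^ α * (1 + (y : ℂ)) ^ β) =
      ∫ y in (-1 : ℝ)..1, (1 + (y : ℂ)) ^ β * (2 - (1 + (y : ℂ))) ^ α := by
    refine intervalIntegral.integral_congr fun y _ => ?_
    have : (2 : ℂ) - (1 + y) = 1 - y := by ring
    simp only [this]
    ring
  norm_num at h4
  rw [h6, h5, h4]
  have h7 := Complex.Gamma_mul_Gamma_eq_betaIntegral (s := β + 1) (t := α + 1)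
    (by simp; linarith) (by simp; linarith)
  have e1 : β + 1 + (α + 1) = α + β + 2 := by ring
  have hG : Complex.Gamma (α + β + 2) ≠ 0 := Complex.Gamma_ne_zero_of_re_pos (by simp; linarith)
  rw [e1] at h7
  rw [mul_comm (Complex.Gamma (α + 1)), h7, mul_div_cancel_left₀ _ hG]
  congr 2
  ring

/-! ### Integration along the contour -/

namespace PochhammerContour

variable (γ : PochhammerContour)

theorem one_sub_path_ne_zero {t : ℝ} (ht : t ∈ Set.Icc (0 : ℝ) 4) : 1 - γ.path t ≠ 0 :=
  γ.exp_logR t ht ▸ Complex.exp_ne_zero _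

theorem one_add_path_ne_zero {t : ℝ} (ht : t ∈ Set.Icc (0 : ℝ) 4) : 1 + γ.path t ≠ 0 :=
  γ.exp_logL t ht ▸ Complex.exp_ne_zero _

theorem continuousOn_weight (α β : ℂ) : ContinuousOn (γ.weight α β) (Set.Icc 0 4) :=
  ((continuousOn_const.mul γ.continuousOn_logR).add
    (continuousOn_const.mul γ.continuousOn_logL)).cexp

theorem continuousOn_eval (p : ℂ[X]) : ContinuousOn (fun t => p.eval (γ.path t)) (Set.Icc 0 4) :=
  p.continuous.comp_continuousOn γ.continuousOn_path

theorem intervalIntegrable_mul_deriv {g : ℝ → ℂ} (hg : ContinuousOn g (Set.Icc 0 4)) :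
    IntervalIntegrable (fun t => g t * deriv γ.path t) MeasureTheory.volume 0 4 :=
  γ.intervalIntegrable_deriv.continuousOn_mul (by rwa [Set.uIcc_of_le (by norm_num)])

theorem intervalIntegrable_integrand (α β : ℂ) (p : ℂ[X]) :
    IntervalIntegrable (fun t => p.eval (γ.path t) * γ.weight α β t * deriv γ.path t)
      MeasureTheory.volume 0 4 :=
  γ.intervalIntegrable_mul_deriv ((γ.continuousOn_eval p).mul (γ.continuousOn_weight α β))

theorem integral_add (α β : ℂ) (p q : ℂ[X]) :
    γ.integral α β (p + q) = γ.integral α β p + γ.integral α β q := by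
  rw [integral, integral, integral, ← intervalIntegral.integral_add
    (γ.intervalIntegrable_integrand α β p) (γ.intervalIntegrable_integrand α β q)]
  refine intervalIntegral.integral_congr fun t _ => ?_
  simp only [eval_add]
  ring

theorem integral_C_mul (α β c : ℂ) (p : ℂ[X]) :
    γ.integral α β (C c * p) = c * γ.integral α β p := by
  rw [integral, integral, ← intervalIntegral.integral_const_mul]
  refine intervalIntegral.integral_congr fun t _ => ?_
  simp only [eval_mul, eval_C]
  ring

theorem integral_sub (α β : ℂ) (p q : ℂ[X]) :
    γ.integral α β (p - q) = γ.integral α β p - γ.integral α β q := by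
  have h : p - q = p + C (-1) * q := by simp [sub_eq_add_neg]
  rw [h, integral_add, integral_C_mul]
  ring

theorem weight_add_one (α β : ℂ) {t : ℝ} (ht : t ∈ Set.Icc (0 : ℝ) 4) :
    γ.weight (α + 1) (β + 1) t = (1 - γ.path t ^ 2) * γ.weight α β t := by
  have h : (1 - γ.path t ^ 2) = Complex.exp (γ.logR t) * Complex.exp (γ.logL t) := by
    rw [γ.exp_logR t ht, γ.exp_logL t ht]; ring
  rw [h, weight, weight, ← Complex.exp_add, ← Complex.exp_add]
  ring_nf

theorem integral_add_one (α β : ℂ) (p : ℂ[X]) :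
    γ.integral (α + 1) (β + 1) p = γ.integral α β ((1 - X ^ 2) * p) := by
  refine intervalIntegral.integral_congr fun t ht => ?_
  rw [Set.uIcc_of_le (by norm_num)] at ht
  simp only [γ.weight_add_one α β ht, eval_mul, eval_sub, eval_one, eval_pow, eval_X]
  ring

theorem weight_four (α β : ℂ) : γ.weight α β 4 = γ.weight α β 0 := by
  have key : ∀ {a b : ℂ}, a.im = 0 → b.im = 0 → Complex.exp a = Complex.exp b → a = b := by
    intro a b ha hb h
    have h1 := congrArg Complex.log h
    rwa [Complex.log_exp, Complex.log_exp] at h1 <;> simp [ha, hb, Real.pi_pos, Real.pi_pos.le]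
  have m0 : (0 : ℝ) ∈ Set.Icc (0 : ℝ) 4 := by constructor <;> norm_num
  have m4 : (4 : ℝ) ∈ Set.Icc (0 : ℝ) 4 := by constructor <;> norm_num
  have hR : γ.logR 4 = γ.logR 0 := key γ.logR_four γ.logR_zero (by
    rw [γ.exp_logR 4 m4, γ.exp_logR 0 m0, γ.closed])
  have hL : γ.logL 4 = γ.logL 0 := key γ.logL_four γ.logL_zero (by
    rw [γ.exp_logL 4 m4, γ.exp_logL 0 m0, γ.closed])
  rw [weight, weight, hR, hL]

/-- The function `(1 - z²) p ω` is a primitive of the integrand along the curve and has equal values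
at both ends: the windings around each of `±1` cancel over the whole contour. -/
theorem integral_pearsonOp (α β : ℂ) (p : ℂ[X]) : γ.integral α β (pearsonOp α β p) = 0 := by
  obtain ⟨S, hS, hd⟩ := γ.differentiableAt_path
  have key := MeasureTheory.integral_eq_of_hasDerivAt_off_countable_of_le
    (fun t => ((1 - X ^ 2) * p).eval (γ.path t) * γ.weight α β t)
    (fun t => (pearsonOp α β p).eval (γ.path t) * γ.weight α β t * deriv γ.path t)
    (by norm_num : (0 : ℝ) ≤ 4) hS
    ((γ.continuousOn_eval _).mul (γ.continuousOn_weight α β))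
    (fun t ht => by
      have htI := Set.Ioo_subset_Icc_self ht.1
      have hnhds : Set.Icc (0 : ℝ) 4 ∈ nhds t := Icc_mem_nhds ht.1.1 ht.1.2
      have hp := (hd t ht).hasDerivAt
      have hR := hasDerivAt_of_exp_eq (γ.continuousOn_logR.continuousAt hnhds)
        (Filter.mem_of_superset hnhds γ.exp_logR) (hp.const_sub 1)
      have hL := hasDerivAt_of_exp_eq (γ.continuousOn_logL.continuousAt hnhds)
        (Filter.mem_of_superset hnhds γ.exp_logL) (hp.const_add 1)
      have hw := ((hR.const_mul α).add (hL.const_mul β)).cexp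
      have he := HasDerivAt.comp t (((1 - X ^ 2) * p).hasDerivAt (γ.path t)) hp
      have hm := γ.one_sub_path_ne_zero htI
      have hq := γ.one_add_path_ne_zero htI
      refine (he.mul hw).congr_deriv ?_
      simp only [pearsonOp, weight, Function.comp_apply, Pi.add_apply, eval_mul, eval_add, eval_sub,
        eval_pow, eval_X, eval_C, eval_one, derivative_mul, derivative_sub, derivative_X_pow,
        derivative_one, eval_zero, Nat.cast_ofNat, Nat.add_one_sub_one, pow_one]
      field_simp
      ring)
    (γ.intervalIntegrable_integrand α β _)
  rw [integral, key, γ.weight_four, γ.closed, sub_self]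

/-! ### The four circuits and the total mass for positive real parts -/

theorem exp_mul_log_add {c : ℝ} (a : ℂ) (w : ℂ) (hc : Complex.exp (c * Complex.I) = 1) :
    Complex.exp ((a + 1) * (Complex.log w + c * Complex.I)) =
      Complex.exp (a * (c * Complex.I)) * Complex.exp ((a + 1) * Complex.log w) := by
  have : (a + 1) * (Complex.log w + c * Complex.I) =
      a * (c * Complex.I) + (a + 1) * Complex.log w + c * Complex.I := by ring
  rw [this, Complex.exp_add, hc, mul_one, Complex.exp_add]

theorem eq_log_add_of_im_eq {v q : ℂ} {c : ℝ} (h : Complex.exp v = q)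
    (hc : Complex.exp (c * Complex.I) = 1) (hv : v.im = c) :
    v = Complex.log q + c * Complex.I ∧ ∃ x : ℝ, 0 < x ∧ q = x := by
  have h1 : q = Complex.exp (v - c * Complex.I) := by rw [Complex.exp_sub, hc, div_one, h]
  have h2 : (v - c * Complex.I).im = 0 := by simp [hv]
  constructor
  · rw [h1, Complex.log_exp (by rw [h2]; linarith [Real.pi_pos]) (by rw [h2]; exact Real.pi_pos.le)]
    ring
  · refine ⟨Real.exp (v - c * Complex.I).re, Real.exp_pos _, ?_⟩
    rw [h1, Complex.ofReal_exp]
    congr 1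
    exact Complex.ext rfl (by rw [h2]; simp)

variable {γ}

/-- Off the cut `(-∞, -1]`, `logL` is the principal logarithm plus the constant `l i`, which
contributes the factor `e^{iβl}`. The change of `logR` appears only in the boundary terms. -/
theorem integral_right_circuit {α : ℂ} (β : ℂ) (hα : 0 < α.re) {a b r s l : ℝ} (ha : 0 ≤ a)
    (hab : a ≤ b) (hb : b ≤ 4) (hslit : ∀ t ∈ Set.Icc a b, 1 + γ.path t ∈ Complex.slitPlane)
    (hr : Complex.exp (r * Complex.I) = 1) (hs : Complex.exp (s * Complex.I) = 1)
    (hl : Complex.exp (l * Complex.I) = 1) (hRa : (γ.logR a).im = r) (hRb : (γ.logR b).im = s)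
    (hLa : (γ.logL a).im = l) :
    ∫ t in a..b, γ.weight α β t * deriv γ.path t = Complex.exp (β * (l * Complex.I)) *
      (Complex.exp (α * (r * Complex.I)) * (Complex.exp ((α + 1) * Complex.log (1 - γ.path a))
          * eulerIntegral α β (1 + γ.path a))
        - Complex.exp (α * (s * Complex.I)) * (Complex.exp ((α + 1) * Complex.log (1 - γ.path b))
          * eulerIntegral α β (1 + γ.path b))) := by
  obtain ⟨S, hS, hd⟩ := γ.differentiableAt_path
  have hsub : Set.Icc a b ⊆ Set.Icc 0 4 := Set.Icc_subset_Icc ha hb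
  have hd' : ∀ t ∈ Set.Ioo a b \ S, DifferentiableAt ℝ γ.path t := fun t ht =>
    hd t ⟨Set.Ioo_subset_Ioo ha hb ht.1, ht.2⟩
  have hpath := γ.continuousOn_path.mono hsub
  have hint : IntervalIntegrable (deriv γ.path) MeasureTheory.volume a b :=
    γ.intervalIntegrable_deriv.mono_set (by
      rwa [Set.uIcc_of_le hab, Set.uIcc_of_le (by norm_num)])
  have hlog : ∀ t ∈ Set.Icc a b, γ.logL t = Complex.log (1 + γ.path t) + l * Complex.I :=
    fun t ht => eq_log_add_of_exp_eq hS (continuousOn_const.add hpath)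
      (fun t ht => (hd' t ht).const_add 1) (γ.continuousOn_logL.mono hsub)
      (fun t ht => γ.exp_logL t (hsub ht)) hslit hl hLa ht
  have h1 := integral_jacobi_branch β hα hab hS hpath hd' hint (γ.continuousOn_logR.mono hsub)
    (fun t ht => γ.exp_logR t (hsub ht)) hslit
  have h2 : (∫ t in a..b, γ.weight α β t * deriv γ.path t) =
      ∫ t in a..b, Complex.exp (β * (l * Complex.I)) *
        (Complex.exp (α * γ.logR t) * (1 + γ.path t) ^ β * deriv γ.path t) := by
    refine intervalIntegral.integral_congr fun t ht => ?_
    rw [Set.uIcc_of_le hab] at ht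
    rw [weight, hlog t ht, Complex.cpow_def_of_ne_zero (Complex.slitPlane_ne_zero (hslit t ht)),
      mul_add, Complex.exp_add, Complex.exp_add, mul_comm β (Complex.log _)]
    ring
  have hRa' := (eq_log_add_of_im_eq (γ.exp_logR a (hsub ⟨le_rfl, hab⟩)) hr hRa).1
  have hRb' := (eq_log_add_of_im_eq (γ.exp_logR b (hsub ⟨hab, le_rfl⟩)) hs hRb).1
  rw [h2, intervalIntegral.integral_const_mul, h1, hRa', hRb', exp_mul_log_add _ _ hr,
    exp_mul_log_add _ _ hs]
  ring

/-- The reflection `z ↦ -z` exchanges the roles of `±1` and of `α`, `β`; the outer minus sign comes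
from `dz`. -/
theorem integral_left_circuit (α : ℂ) {β : ℂ} (hβ : 0 < β.re) {a b r s l : ℝ} (ha : 0 ≤ a)
    (hab : a ≤ b) (hb : b ≤ 4) (hslit : ∀ t ∈ Set.Icc a b, 1 - γ.path t ∈ Complex.slitPlane)
    (hr : Complex.exp (r * Complex.I) = 1) (hs : Complex.exp (s * Complex.I) = 1)
    (hl : Complex.exp (l * Complex.I) = 1) (hLa : (γ.logL a).im = r) (hLb : (γ.logL b).im = s)
    (hRa : (γ.logR a).im = l) :
    ∫ t in a..b, γ.weight α β t * deriv γ.path t = -(Complex.exp (α * (l * Complex.I)) *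
      (Complex.exp (β * (r * Complex.I)) * (Complex.exp ((β + 1) * Complex.log (1 + γ.path a))
          * eulerIntegral β α (1 - γ.path a))
        - Complex.exp (β * (s * Complex.I)) * (Complex.exp ((β + 1) * Complex.log (1 + γ.path b))
          * eulerIntegral β α (1 - γ.path b)))) := by
  obtain ⟨S, hS, hd⟩ := γ.differentiableAt_path
  have hsub : Set.Icc a b ⊆ Set.Icc 0 4 := Set.Icc_subset_Icc ha hb
  have hd' : ∀ t ∈ Set.Ioo a b \ S, DifferentiableAt ℝ γ.path t := fun t ht =>
    hd t ⟨Set.Ioo_subset_Ioo ha hb ht.1, ht.2⟩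
  have hpath := γ.continuousOn_path.mono hsub
  have hderiv : deriv (fun t => -γ.path t) = fun t => -deriv γ.path t := by
    funext t
    exact deriv.fun_neg
  have hint : IntervalIntegrable (deriv fun t => -γ.path t) MeasureTheory.volume a b := by
    rw [hderiv]
    exact (γ.intervalIntegrable_deriv.mono_set (by
      rwa [Set.uIcc_of_le hab, Set.uIcc_of_le (by norm_num)])).neg
  have hlog : ∀ t ∈ Set.Icc a b, γ.logR t = Complex.log (1 - γ.path t) + l * Complex.I :=
    fun t ht => eq_log_add_of_exp_eq hS (continuousOn_const.sub hpath)
      (fun t ht => (hd' t ht).const_sub 1) (γ.continuousOn_logR.mono hsub)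
      (fun t ht => γ.exp_logR t (hsub ht)) hslit hl hRa ht
  have h1 := integral_jacobi_branch (z := fun t => -γ.path t) α hβ hab hS hpath.neg
    (fun t ht => (hd' t ht).neg) hint (γ.continuousOn_logL.mono hsub)
    (fun t ht => by rw [γ.exp_logL t (hsub ht), sub_neg_eq_add])
    (fun t ht => by rw [← sub_eq_add_neg]; exact hslit t ht)
  rw [hderiv] at h1
  simp only [← sub_eq_add_neg] at h1
  have h2 : (∫ t in a..b, γ.weight α β t * deriv γ.path t) =
      ∫ t in a..b, -Complex.exp (α * (l * Complex.I)) *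
        (Complex.exp (β * γ.logL t) * (1 - γ.path t) ^ α * -deriv γ.path t) := by
    refine intervalIntegral.integral_congr fun t ht => ?_
    rw [Set.uIcc_of_le hab] at ht
    rw [weight, hlog t ht, Complex.cpow_def_of_ne_zero (Complex.slitPlane_ne_zero (hslit t ht)),
      mul_add, Complex.exp_add, Complex.exp_add, mul_comm α (Complex.log _)]
    ring
  have hLa' := (eq_log_add_of_im_eq (γ.exp_logL a (hsub ⟨le_rfl, hab⟩)) hr hLa).1
  have hLb' := (eq_log_add_of_im_eq (γ.exp_logL b (hsub ⟨hab, le_rfl⟩)) hs hLb).1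
  rw [h2, intervalIntegral.integral_const_mul, h1, hLa', hLb', exp_mul_log_add _ _ hr,
    exp_mul_log_add _ _ hs]
  ring

theorem path_eq_real {t r l : ℝ} (ht : t ∈ Set.Icc (0 : ℝ) 4)
    (hr : Complex.exp (r * Complex.I) = 1) (hl : Complex.exp (l * Complex.I) = 1)
    (hR : (γ.logR t).im = r) (hL : (γ.logL t).im = l) :
    ∃ x : ℝ, -1 < x ∧ x < 1 ∧ γ.path t = x := by
  obtain ⟨x, hx, h1⟩ := (eq_log_add_of_im_eq (γ.exp_logR t ht) hr hR).2
  obtain ⟨y, hy, h2⟩ := (eq_log_add_of_im_eq (γ.exp_logL t ht) hl hL).2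
  have hz : γ.path t = ((1 - x : ℝ) : ℂ) := by push_cast; rw [← h1]; ring
  rw [hz] at h2
  have h3 : 1 + (1 - x) = y := by exact_mod_cast h2
  exact ⟨1 - x, by linarith, by linarith, hz⟩

theorem exp_two_pi_I : Complex.exp (((2 * Real.pi : ℝ) : ℂ) * Complex.I) = 1 := by
  push_cast
  exact Complex.exp_two_pi_mul_I

variable (γ)

theorem integral_one_of_re_pos {α β : ℂ} (hα : 0 < α.re) (hβ : 0 < β.re) :
    γ.integral α β 1 = (1 - Complex.exp (2 * Real.pi * Complex.I * α))
      * (1 - Complex.exp (2 * Real.pi * Complex.I * β))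
      * (2 ^ (α + β + 1) * (Complex.Gamma (α + 1) * Complex.Gamma (β + 1)
        / Complex.Gamma (α + β + 2))) := by
  have h0 : Complex.exp (((0 : ℝ) : ℂ) * Complex.I) = 1 := by simp
  have h2 := exp_two_pi_I
  have hii : ∀ c ∈ Set.Icc (0 : ℝ) 4, ∀ d ∈ Set.Icc (0 : ℝ) 4, IntervalIntegrable
      (fun t => γ.weight α β t * deriv γ.path t) MeasureTheory.volume c d := by
    intro c hc d hd
    refine (γ.intervalIntegrable_mul_deriv (γ.continuousOn_weight α β)).mono_set ?_
    rw [Set.uIcc_of_le (by norm_num : (0 : ℝ) ≤ 4)]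
    exact Set.uIcc_subset_Icc hc hd
  have m0 : (0 : ℝ) ∈ Set.Icc (0 : ℝ) 4 := by constructor <;> norm_num
  have m1 : (1 : ℝ) ∈ Set.Icc (0 : ℝ) 4 := by constructor <;> norm_num
  have m2 : (2 : ℝ) ∈ Set.Icc (0 : ℝ) 4 := by constructor <;> norm_num
  have m3 : (3 : ℝ) ∈ Set.Icc (0 : ℝ) 4 := by constructor <;> norm_num
  have m4 : (4 : ℝ) ∈ Set.Icc (0 : ℝ) 4 := by constructor <;> norm_num
  have hsplit : γ.integral α β 1 = (∫ t in (0 : ℝ)..1, γ.weight α β t * deriv γ.path t)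
      + (∫ t in (1 : ℝ)..2, γ.weight α β t * deriv γ.path t)
      + (∫ t in (2 : ℝ)..3, γ.weight α β t * deriv γ.path t)
      + (∫ t in (3 : ℝ)..4, γ.weight α β t * deriv γ.path t) := by
    rw [intervalIntegral.integral_add_adjacent_intervals (hii 0 m0 1 m1) (hii 1 m1 2 m2),
      intervalIntegral.integral_add_adjacent_intervals (hii 0 m0 2 m2) (hii 2 m2 3 m3),
      intervalIntegral.integral_add_adjacent_intervals (hii 0 m0 3 m3) (hii 3 m3 4 m4), integral]
    simp
  have hsum : ∀ t ∈ Set.Icc (0 : ℝ) 4, ∀ r l : ℝ, Complex.exp (r * Complex.I) = 1 →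
      Complex.exp (l * Complex.I) = 1 → (γ.logR t).im = r → (γ.logL t).im = l →
      Complex.exp ((α + 1) * Complex.log (1 - γ.path t)) * eulerIntegral α β (1 + γ.path t)
      + Complex.exp ((β + 1) * Complex.log (1 + γ.path t)) * eulerIntegral β α (1 - γ.path t) =
      2 ^ (α + β + 1) * (Complex.Gamma (α + 1) * Complex.Gamma (β + 1)
        / Complex.Gamma (α + β + 2)) := by
    intro t ht r l hr hl hR hL
    obtain ⟨x, hx, hx', hz⟩ := path_eq_real ht hr hl hR hL
    rw [hz]
    exact exp_log_mul_eulerIntegral_add hα hβ hx hx'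
  have s0 := hsum 0 m0 _ _ h0 h0 γ.logR_zero γ.logL_zero
  have s1 := hsum 1 m1 _ _ h2 h0 γ.logR_one γ.logL_one
  have s2 := hsum 2 m2 _ _ h2 h2 γ.logR_two γ.logL_two
  have s3 := hsum 3 m3 _ _ h0 h2 γ.logR_three γ.logL_three
  rw [hsplit,
    integral_right_circuit β hα le_rfl zero_le_one (by norm_num) γ.avoids_left_first
      h0 h2 h0 γ.logR_zero γ.logR_one γ.logL_zero,
    integral_left_circuit α hβ zero_le_one (by norm_num) (by norm_num) γ.avoids_right_second
      h0 h2 h2 γ.logL_one γ.logL_two γ.logR_one,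
    integral_right_circuit β hα zero_le_two (by norm_num) (by norm_num) γ.avoids_left_third
      h2 h0 h2 γ.logR_two γ.logR_three γ.logL_two,
    integral_left_circuit α hβ (by norm_num) (by norm_num) le_rfl γ.avoids_right_fourth
      h2 h0 h0 γ.logL_three γ.logL_four γ.logR_three, γ.closed]
  have ea : ∀ c : ℂ, c * (((2 * Real.pi : ℝ) : ℂ) * Complex.I) = 2 * Real.pi * Complex.I * c := by
    intro c; push_cast; ring
  simp only [ea, Complex.ofReal_zero, zero_mul, mul_zero, Complex.exp_zero, one_mul]
  -- Let `R_j`, `L_j` be the right and left boundary terms at time `j`, and `A = e^{2πiα}`, `B =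
  -- e^{2πiβ}`. The circuits give `(R₀ - A R₁) - A(L₁ - B L₂) + B(A R₂ - R₃) - (B L₃ - L₀)`. Each
  -- `R_j + L_j` is the same beta integral, whence the factor `1 - A + AB - B = (1-A)(1-B)`.
  linear_combination s0 - Complex.exp (2 * Real.pi * Complex.I * α) * s1
    + Complex.exp (2 * Real.pi * Complex.I * α) * Complex.exp (2 * Real.pi * Complex.I * β) * s2
    - Complex.exp (2 * Real.pi * Complex.I * β) * s3

end PochhammerContour

/-! ### Reflection formula and continuation in the parameters -/

/-- Euler's reflection formula at `-a`, combined with `1 - e^{2πia} = -2i e^{πia} sin(πa)`. -/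
theorem one_sub_exp_mul_Gamma {a : ℂ} (ha : ∀ k : ℕ, a ≠ -((k : ℂ) + 1)) :
    (1 - Complex.exp (2 * Real.pi * Complex.I * a)) * Complex.Gamma (a + 1) =
      2 * Real.pi * Complex.I * Complex.exp (Real.pi * Complex.I * a) / Complex.Gamma (-a) := by
  have hG : Complex.Gamma (a + 1) ≠ 0 := Complex.Gamma_ne_zero fun m hm =>
    ha m (by linear_combination hm)
  have hr := Complex.Gamma_mul_Gamma_one_sub (-a)
  rw [sub_neg_eq_add, add_comm 1 a, mul_neg, Complex.sin_neg] at hr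
  have hsin : 1 - Complex.exp (2 * Real.pi * Complex.I * a) =
      -(2 * Complex.I * Complex.exp (Real.pi * Complex.I * a) * Complex.sin (Real.pi * a)) := by
    have e1 : Complex.exp (2 * Real.pi * Complex.I * a) =
        Complex.exp (Real.pi * Complex.I * a) * Complex.exp (Real.pi * Complex.I * a) := by
      rw [← Complex.exp_add]; ring_nf
    have e2 : Complex.exp (Real.pi * Complex.I * a) * Complex.exp (-(Real.pi * a) * Complex.I) = 1 := by
      rw [← Complex.exp_add, ← Complex.exp_zero]; ring_nf
    have e3 : Complex.exp (Real.pi * a * Complex.I) = Complex.exp (Real.pi * Complex.I * a) := by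
      ring_nf
    rw [Complex.sin, e1, e3]
    linear_combination (Complex.exp (Real.pi * Complex.I * a) *
      Complex.exp (-(Real.pi * a) * Complex.I) - Complex.exp (Real.pi * Complex.I * a) *
        Complex.exp (Real.pi * Complex.I * a)) * Complex.I_sq - e2
  rw [hsin]
  -- If the sine vanishes, `-a` is a pole, where `Complex.Gamma` takes the value `0`; division by it
  -- gives `0`, as `1/Γ` should.
  rcases eq_or_ne (Complex.sin (Real.pi * a)) 0 with h0 | h0
  · rw [h0, neg_zero, div_zero] at hr
    rw [h0, (mul_eq_zero.1 hr).resolve_right hG]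
    simp
  · have hpi : (Real.pi : ℂ) ≠ 0 := Complex.ofReal_ne_zero.2 Real.pi_ne_zero
    have hG' : Complex.Gamma (-a) ≠ 0 := fun h => by
      rw [h, zero_mul, eq_comm, div_eq_zero_iff] at hr
      exact hr.elim hpi (neg_ne_zero.2 h0)
    rw [eq_div_iff (neg_ne_zero.2 h0)] at hr
    rw [eq_div_iff hG']
    linear_combination (2 * Complex.I * Complex.exp (Real.pi * Complex.I * a)) * hr

namespace PochhammerContour

variable (γ : PochhammerContour)

theorem differentiable_integral_exp {g h : ℝ → ℂ} (hg : ContinuousOn g (Set.Icc 0 4))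
    (hh : ContinuousOn h (Set.Icc 0 4)) : Differentiable ℂ fun c : ℂ =>
      ∫ t in (0 : ℝ)..4, Complex.exp (c * g t + h t) * deriv γ.path t := by
  intro c₀
  have hIoc : Set.uIoc (0 : ℝ) 4 ⊆ Set.Icc 0 4 := by
    rw [Set.uIoc_of_le (by norm_num)]; exact Set.Ioc_subset_Icc_self
  have hexp : ∀ c : ℂ, ContinuousOn (fun t => Complex.exp (c * g t + h t)) (Set.Icc 0 4) := fun c =>
    ((continuousOn_const.mul hg).add hh).cexp
  have hcont : ContinuousOn (fun x : ℂ × ℝ => g x.2 * Complex.exp (x.1 * g x.2 + h x.2))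
      (Metric.closedBall c₀ 1 ×ˢ Set.Icc (0 : ℝ) 4) := by
    have h1 : ContinuousOn (fun x : ℂ × ℝ => g x.2) (Metric.closedBall c₀ 1 ×ˢ Set.Icc (0 : ℝ) 4) :=
      hg.comp continuousOn_snd fun x hx => hx.2
    have h2 : ContinuousOn (fun x : ℂ × ℝ => h x.2) (Metric.closedBall c₀ 1 ×ˢ Set.Icc (0 : ℝ) 4) :=
      hh.comp continuousOn_snd fun x hx => hx.2
    exact h1.mul ((continuousOn_fst.mul h1).add h2).cexp
  obtain ⟨M, hM⟩ := ((isCompact_closedBall c₀ 1).prod isCompact_Icc).exists_bound_of_continuousOn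
    hcont
  refine (intervalIntegral.hasDerivAt_integral_of_dominated_loc_of_deriv_le
    (F' := fun c t => g t * Complex.exp (c * g t + h t) * deriv γ.path t)
    (bound := fun t => M * ‖deriv γ.path t‖) (Metric.closedBall_mem_nhds c₀ one_pos) ?_
    (γ.intervalIntegrable_mul_deriv (hexp c₀)) ?_ ?_
    (γ.intervalIntegrable_deriv.norm.const_mul M) ?_).2.differentiableAt
  · exact Filter.Eventually.of_forall fun c =>
      (γ.intervalIntegrable_mul_deriv (hexp c)).def'.aestronglyMeasurable
  · exact (γ.intervalIntegrable_mul_deriv (hg.mul (hexp c₀))).def'.aestronglyMeasurable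
  · refine Filter.Eventually.of_forall fun t ht c hc => ?_
    rw [norm_mul]
    exact mul_le_mul_of_nonneg_right (hM (c, t) ⟨hc, hIoc ht⟩) (norm_nonneg _)
  · refine Filter.Eventually.of_forall fun t _ c _ => ?_
    have h1 := ((((hasDerivAt_id c).mul_const (g t)).add_const (h t)).cexp).mul_const
      (deriv γ.path t)
    refine h1.congr_deriv ?_
    simp only [id]
    ring

/-- Both sides are entire in each variable separately, because `1/Γ` is entire and the contour
avoids `±1`. They agree for positive real parts. -/
theorem integral_one_eq (α β : ℂ) : γ.integral α β 1 =
    -(4 * (Real.pi : ℂ) ^ 2 * Complex.exp (Real.pi * Complex.I * (α + β)))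
      * (2 : ℂ) ^ (α + β + 1) * (Complex.Gamma (-α))⁻¹ * (Complex.Gamma (-β))⁻¹
      * (Complex.Gamma (α + β + 2))⁻¹ := by
  set F : ℂ → ℂ → ℂ := fun α β =>
    -(4 * (Real.pi : ℂ) ^ 2 * Complex.exp (Real.pi * Complex.I * (α + β)))
      * (2 : ℂ) ^ (α + β + 1) * (Complex.Gamma (-α))⁻¹ * (Complex.Gamma (-β))⁻¹
      * (Complex.Gamma (α + β + 2))⁻¹ with hF
  change _ = F α β
  have hentire : ∀ f : ℂ → ℂ, Differentiable ℂ f → AnalyticOnNhd ℂ f Set.univ := fun f hf =>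
    Complex.analyticOnNhd_univ_iff_differentiable.2 hf
  have hpow : Differentiable ℂ fun s : ℂ => (2 : ℂ) ^ s := fun s =>
    DifferentiableAt.const_cpow differentiableAt_id (Or.inl two_ne_zero)
  have hGd := Complex.differentiable_one_div_Gamma
  have hF1 : ∀ β, Differentiable ℂ fun α => F α β := fun β => by
    have g1 : Differentiable ℂ fun α : ℂ => (2 : ℂ) ^ (α + β + 1) :=
      hpow.comp (g := fun s : ℂ => (2 : ℂ) ^ s) (by fun_prop)
    have g2 : Differentiable ℂ fun α : ℂ => (Complex.Gamma (-α))⁻¹ := hGd.comp differentiable_neg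
    have g3 : Differentiable ℂ fun α : ℂ => (Complex.Gamma (α + β + 2))⁻¹ :=
      hGd.comp (g := fun s : ℂ => (Complex.Gamma s)⁻¹) (by fun_prop)
    have g4 : Differentiable ℂ fun α : ℂ =>
        -(4 * (Real.pi : ℂ) ^ 2 * Complex.exp (Real.pi * Complex.I * (α + β))) := by fun_prop
    exact ((((g4.mul g1).mul g2).mul_const _).mul g3)
  have hFsymm : ∀ α β, F α β = F β α := fun α β => by
    simp only [hF, add_comm α β]
    ring
  have hF2 : ∀ α, Differentiable ℂ fun β => F α β := fun α => by
    simpa only [hFsymm α] using hF1 α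
  have hL1 : ∀ β, Differentiable ℂ fun α => γ.integral α β 1 := fun β => by
    have := γ.differentiable_integral_exp γ.continuousOn_logR
      (h := fun t => β * γ.logL t) (continuousOn_const.mul γ.continuousOn_logL)
    simpa [integral, weight] using this
  have hL2 : ∀ α, Differentiable ℂ fun β => γ.integral α β 1 := fun α => by
    have := γ.differentiable_integral_exp γ.continuousOn_logL
      (h := fun t => α * γ.logR t) (continuousOn_const.mul γ.continuousOn_logR)
    simpa [integral, weight, add_comm] using this
  have hpos : ∀ α β : ℂ, 0 < α.re → 0 < β.re → γ.integral α β 1 = F α β := by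
    intro α β hα hβ
    have hne : ∀ a : ℂ, 0 < a.re → ∀ k : ℕ, a ≠ -((k : ℂ) + 1) := by
      intro a ha k h
      have := congrArg Complex.re h
      simp at this
      linarith [k.cast_nonneg (α := ℝ)]
    have h1 := one_sub_exp_mul_Gamma (hne α hα)
    have h2 := one_sub_exp_mul_Gamma (hne β hβ)
    have h3 : ∀ a b c d e f : ℂ, a * b * (c * (d * e / f)) = (a * d) * (b * e) * c * f⁻¹ := by
      intros; ring
    rw [γ.integral_one_of_re_pos hα hβ, h3, h1, h2]
    simp only [hF]
    rw [mul_add, Complex.exp_add, div_eq_mul_inv, div_eq_mul_inv]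
    ring_nf
    rw [Complex.I_sq]
    ring
  have hre : ∀ᶠ a : ℂ in nhds 1, 0 < a.re :=
    (isOpen_lt continuous_const Complex.continuous_re).mem_nhds (by simp)
  -- The identity theorem near `1` frees `α` while `Re β > 0`; a second application then frees `β`.
  have hstep : ∀ α β : ℂ, 0 < β.re → γ.integral α β 1 = F α β := fun α β hβ =>
    congrFun ((hentire _ (hL1 β)).eq_of_eventuallyEq (hentire _ (hF1 β)) (z₀ := 1)
      (hre.mono fun a ha => hpos a β ha hβ)) α
  exact congrFun ((hentire _ (hL2 α)).eq_of_eventuallyEq (hentire _ (hF2 α)) (z₀ := 1)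
    (hre.mono fun b hb => hstep α b hb)) β

/-! ### Orthogonality, norms and moments -/

variable {α β : ℂ}

theorem integral_jacobiMonic_succ_mul (hαβ : ∀ k : ℕ, α + β ≠ -((k : ℂ) + 2)) (n : ℕ) (p : ℂ[X]) :
    (α + β + n + 2) * γ.integral α β (jacobiMonic α β (n + 1) * p) =
      γ.integral (α + 1) (β + 1) (jacobiMonic (α + 1) (β + 1) n * derivative p) := by
  have h := γ.integral_pearsonOp α β (jacobiMonic (α + 1) (β + 1) n * p)
  rw [pearsonOp_mul, integral_add, pearsonOp_jacobiMonic α β hαβ, ← integral_add_one, ← C_neg,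
    mul_assoc, integral_C_mul] at h
  linear_combination -h

/-- Each integration by parts lowers the index `n` and differentiates `p`, while `α + β` grows by
`2`, which preserves the hypothesis. After `n` steps `p` has been differentiated to zero. -/
theorem integral_jacobiMonic_mul_of_degree_lt (hαβ : ∀ k : ℕ, α + β ≠ -((k : ℂ) + 2)) (n : ℕ)
    (p : ℂ[X]) (hp : p.degree < (n : WithBot ℕ)) :
    γ.integral α β (jacobiMonic α β n * p) = 0 := by
  induction n generalizing α β p with
  | zero =>
    have : p = 0 := by
      rw [← degree_eq_bot]
      exact Nat.WithBot.lt_zero_iff.1 hp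
    rw [this, mul_zero]
    simp [integral]
  | succ n ih =>
    have h := γ.integral_jacobiMonic_succ_mul hαβ n p
    have h1 : γ.integral (α + 1) (β + 1) (jacobiMonic (α + 1) (β + 1) n * derivative p) = 0 := by
      refine ih (fun k hk => hαβ (k + 2) ?_) _ ?_
      · push_cast
        linear_combination hk
      · rcases eq_or_ne p 0 with rfl | hp0
        · simp
        · exact (degree_derivative_lt hp0).trans_le
            (degree_le_of_natDegree_le (Nat.lt_succ_iff.1 ((natDegree_lt_iff_degree_lt hp0).2 hp)))
    rw [h1] at h
    exact (mul_eq_zero.1 h).resolve_left fun h0 => hαβ n (by linear_combination h0)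

theorem integral_jacobiMonic_mul_jacobiMonic (hαβ : ∀ k : ℕ, α + β ≠ -((k : ℂ) + 2)) (n m : ℕ) :
    γ.integral α β (jacobiMonic α β n * jacobiMonic α β m) =
      if m = n then γ.jacobiNormSq α β n else 0 := by
  have hdeg : ∀ k, (jacobiMonic α β k).degree = (k : WithBot ℕ) := fun k => by
    rw [degree_eq_natDegree (jacobiMonic_monic α β k).ne_zero, natDegree_jacobiMonic]
  rcases lt_trichotomy m n with h | rfl | h
  · rw [if_neg h.ne]
    exact γ.integral_jacobiMonic_mul_of_degree_lt hαβ n _ (by rw [hdeg]; exact_mod_cast h)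
  · rw [if_pos rfl, jacobiNormSq, pow_two]
  · rw [if_neg h.ne', mul_comm]
    exact γ.integral_jacobiMonic_mul_of_degree_lt hαβ m _ (by rw [hdeg]; exact_mod_cast h)

theorem jacobiNormSq_succ (hαβ : ∀ k : ℕ, α + β ≠ -((k : ℂ) + 2)) (n : ℕ) :
    (α + β + n + 2) * γ.jacobiNormSq α β (n + 1) =
      (n + 1) * γ.jacobiNormSq (α + 1) (β + 1) n := by
  have h := γ.integral_jacobiMonic_succ_mul hαβ n (jacobiMonic α β (n + 1))
  have hd := derivative_jacobiMonic_succ (α + 1) (β + 1) n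
  rw [add_sub_cancel_right, add_sub_cancel_right] at hd
  rw [hd, mul_left_comm, integral_C_mul, ← pow_two, ← pow_two] at h
  exact h

/-- Passing from `(n + 1, α, β)` to `(n, α + 1, β + 1)` changes only `n!` and the Pochhammer factor,
exactly as `jacobiNormSq_succ` demands; the exponential gains a trivial `e^{2πi}`. At a pole of `Γ`
the division by `0` yields the intended `0`. -/
theorem jacobiNormSq_eq (hαβ : ∀ k : ℕ, α + β ≠ -((k : ℂ) + 2)) (n : ℕ) :
    γ.jacobiNormSq α β n =
      -(4 * (Real.pi : ℂ) ^ 2 * Complex.exp (Real.pi * Complex.I * (α + β)))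
        * (2 : ℂ) ^ (2 * (n : ℂ) + α + β + 1) * (n.factorial : ℂ)
        / (Complex.Gamma (-α - n) * Complex.Gamma (-β - n)
          * (ascPochhammer ℂ n).eval (α + β + n + 1) * Complex.Gamma (α + β + 2 * n + 2)) := by
  induction n generalizing α β with
  | zero =>
    rw [jacobiNormSq, jacobiMonic_zero, one_pow, integral_one_eq]
    simp only [Nat.cast_zero, mul_zero, zero_add, sub_zero, add_zero, Nat.factorial_zero,
      Nat.cast_one, mul_one, ascPochhammer_zero, eval_one]
    rw [div_eq_mul_inv, mul_inv, mul_inv]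
    ring
  | succ n ih =>
    have hne : α + β + n + 2 ≠ 0 := fun h => hαβ n (by linear_combination h)
    have h := γ.jacobiNormSq_succ hαβ n
    rw [ih (fun k hk => hαβ (k + 2) (by push_cast; linear_combination hk))] at h
    rw [← mul_right_inj' hne, h, ascPochhammer_succ_eval_left, Nat.factorial_succ]
    have e1 : Real.pi * Complex.I * (α + 1 + (β + 1)) =
        Real.pi * Complex.I * (α + β) + 2 * Real.pi * Complex.I := by ring
    have e2 : 2 * (n : ℂ) + (α + 1) + (β + 1) + 1 = 2 * ((n + 1 : ℕ) : ℂ) + α + β + 1 := by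
      push_cast; ring
    have e3 : ∀ a : ℂ, -(a + 1) - (n : ℂ) = -a - ((n + 1 : ℕ) : ℂ) := fun a => by push_cast; ring
    have e4 : α + 1 + (β + 1) + (n : ℂ) + 1 = α + β + ((n + 1 : ℕ) : ℂ) + 1 + 1 := by
      push_cast; ring
    have e5 : α + 1 + (β + 1) + 2 * (n : ℂ) + 2 = α + β + 2 * ((n + 1 : ℕ) : ℂ) + 2 := by
      push_cast; ring
    have e6 : α + β + ((n + 1 : ℕ) : ℂ) + 1 = α + β + n + 2 := by push_cast; ring
    rw [e1, e2, e3, e3, e4, e5, e6, Complex.exp_add, Complex.exp_two_pi_mul_I, mul_one, Nat.cast_mul,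
      div_eq_mul_inv, div_eq_mul_inv]
    simp only [mul_inv]
    push_cast
    field_simp

theorem jacobiNormSq_eq_Gamma (hαβ : ∀ k : ℕ, α + β ≠ -((k : ℂ) + 2))
    (hα : ∀ k : ℕ, α ≠ -((k : ℂ) + 1)) (hβ : ∀ k : ℕ, β ≠ -((k : ℂ) + 1)) (n : ℕ)
    (hn : n = 0 → α + β ≠ -1) : γ.jacobiNormSq α β n =
      (1 - Complex.exp (2 * Real.pi * Complex.I * α))
        * (1 - Complex.exp (2 * Real.pi * Complex.I * β))
        * ((2 : ℂ) ^ (2 * (n : ℂ) + α + β + 1) * (n.factorial : ℂ)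
          * Complex.Gamma (α + n + 1) * Complex.Gamma (β + n + 1)
          * Complex.Gamma (α + β + n + 1)
          / (Complex.Gamma (α + β + 2 * n + 1) * Complex.Gamma (α + β + 2 * n + 2))) := by
  have hshift : ∀ a : ℂ, (∀ k : ℕ, a ≠ -((k : ℂ) + 1)) →
      (1 - Complex.exp (2 * Real.pi * Complex.I * a)) * Complex.Gamma (a + n + 1) =
        2 * Real.pi * Complex.I * Complex.exp (Real.pi * Complex.I * (a + n))
          / Complex.Gamma (-a - n) := by
    intro a ha
    have h := one_sub_exp_mul_Gamma (a := a + n) fun k hk => ha (n + k) (by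
      push_cast; linear_combination hk)
    have e : 2 * Real.pi * Complex.I * (a + n) =
        2 * Real.pi * Complex.I * a + n * (2 * Real.pi * Complex.I) := by ring
    rw [e, Complex.exp_add, Complex.exp_nat_mul_two_pi_mul_I, mul_one, neg_add'] at h
    exact h
  have hG : Complex.Gamma (α + β + n + 1) ≠ 0 := by
    refine Complex.Gamma_ne_zero fun m hm => ?_
    -- The hypothesis on `α + β` excludes every pole of `Γ(α + β + n + 1)` except `α + β = -1` with
    -- `n = 0`, which `hn` excludes.
    rcases Nat.eq_zero_or_pos (n + m) with h0 | h0
    · obtain ⟨rfl, rfl⟩ := Nat.add_eq_zero_iff.1 h0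
      exact hn rfl (by push_cast at hm; linear_combination hm)
    · refine hαβ (n + m - 1) ?_
      rw [Nat.cast_sub h0]
      push_cast
      linear_combination hm
  have hGn : Complex.Gamma (α + β + 2 * n + 1) =
      (ascPochhammer ℂ n).eval (α + β + n + 1) * Complex.Gamma (α + β + n + 1) := by
    clear hG hshift hn
    have : ∀ x : ℂ, (∀ j < n, x + (j : ℂ) ≠ 0) → Complex.Gamma (x + n) =
        (ascPochhammer ℂ n).eval x * Complex.Gamma x := by
      intro x
      induction n with
      | zero => intro _; simp
      | succ n ih =>
        intro hx
        rw [ascPochhammer_succ_eval, Nat.cast_succ, ← add_assoc,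
          Complex.Gamma_add_one _ (hx n n.lt_succ_self), ih fun j hj => hx j (hj.trans n.lt_succ_self)]
        ring
    rw [← this _ fun j hj h => hαβ (n + j - 1) (by
      rw [Nat.cast_sub (by omega)]
      push_cast
      linear_combination h)]
    congr 1
    ring
  have h3 : ∀ a b c d e f g k : ℂ, a * b * (c * d * e * f * g / k) =
      (a * e) * (b * f) * c * d * (g / k) := by intros; ring
  rw [γ.jacobiNormSq_eq hαβ, h3, hshift α hα, hshift β hβ, hGn,
    mul_right_comm _ (Complex.Gamma (α + β + n + 1)), div_mul_cancel_right₀ hG]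
  have e1 : Complex.exp (Real.pi * Complex.I * (α + n)) * Complex.exp (Real.pi * Complex.I * (β + n)) =
      Complex.exp (Real.pi * Complex.I * (α + β)) := by
    rw [← Complex.exp_add]
    have : Real.pi * Complex.I * (α + n) + Real.pi * Complex.I * (β + n) =
        Real.pi * Complex.I * (α + β) + n * (2 * Real.pi * Complex.I) := by ring
    rw [this, Complex.exp_add, Complex.exp_nat_mul_two_pi_mul_I, mul_one]
  rw [← e1]
  simp only [div_eq_mul_inv, mul_inv]
  have hI := Complex.I_sq
  generalize Complex.exp (Real.pi * Complex.I * (α + n)) = A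
  generalize Complex.exp (Real.pi * Complex.I * (β + n)) = B
  linear_combination (-(4 * (Real.pi : ℂ) ^ 2 * A * B)
    * (2 : ℂ) ^ (2 * (n : ℂ) + α + β + 1) * (n.factorial : ℂ)
    * ((Complex.Gamma (-α - n))⁻¹ * (Complex.Gamma (-β - n))⁻¹
      * ((ascPochhammer ℂ n).eval (α + β + n + 1))⁻¹ * (Complex.Gamma (α + β + 2 * n + 2))⁻¹)) * hI

theorem integral_polarJacobi_mul (hαβ : ∀ k : ℕ, α + β ≠ -((k : ℂ) + 2)) (ξ : ℂ) {n : ℕ}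
    (hn : 1 < n) (m : ℕ) :
    γ.integral α β ((X - C ξ) * polarJacobi α β ξ n * jacobiMonic α β m) =
      (if m = n + 1 then γ.jacobiNormSq α β (n + 1) else 0)
        + betaTilde α β n * (if m = n then γ.jacobiNormSq α β n else 0)
        + gammaTilde α β n * (if m = n - 1 then γ.jacobiNormSq α β (n - 1) else 0)
        - (jacobiMonic (α - 1) (β - 1) (n + 1)).eval ξ *
          (if m = 0 then γ.jacobiNormSq α β 0 else 0) := by
  -- The constant `P_{n+1}^{(α-1,β-1)}(ξ)` is a multiple of the Jacobi polynomial of degree `0`, so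
  -- orthogonality applies to it too.
  have h0 : jacobiMonic α β m = jacobiMonic α β 0 * jacobiMonic α β m := by simp
  rw [X_sub_C_mul_polarJacobi, sub_mul, integral_sub, integral_C_mul,
    jacobiMonic_sub_one_eq α β hαβ n hn, add_mul, add_mul, integral_add, integral_add, mul_assoc,
    mul_assoc, integral_C_mul, integral_C_mul, γ.integral_jacobiMonic_mul_jacobiMonic hαβ,
    γ.integral_jacobiMonic_mul_jacobiMonic hαβ, γ.integral_jacobiMonic_mul_jacobiMonic hαβ]
  conv_lhs => rw [h0, γ.integral_jacobiMonic_mul_jacobiMonic hαβ]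

theorem integral_polarJacobi_mul_zero (hαβ : ∀ k : ℕ, α + β ≠ -((k : ℂ) + 2)) (ξ : ℂ) {n : ℕ}
    (hn : 1 < n) :
    γ.integral α β ((X - C ξ) * polarJacobi α β ξ n * jacobiMonic α β 0) =
      -γ.jacobiNormSq α β 0 * (jacobiMonic (α - 1) (β - 1) (n + 1)).eval ξ := by
  rw [γ.integral_polarJacobi_mul hαβ ξ hn, if_neg (by omega), if_neg (by omega), if_neg (by omega),
    if_pos rfl]
  ring

end PochhammerContour

/-! ### The theorem -/

theorem theorem1 (γ : PochhammerContour) (α β ξ : ℂ)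
    (hαβ : ∀ k : ℕ, α + β ≠ -((k : ℂ) + 2)) :
    -- orthogonality of `L_ξ[P_n]`
    (∀ n m : ℕ, γ.integral α β (polarOp ξ (polarJacobi α β ξ n) * jacobiMonic α β m) =
      if m = n then ((n : ℂ) + 1) * γ.jacobiNormSq α β n else 0) ∧
    -- the moments of `(z - ξ) P_n`, for `n > 1`
    (∀ n : ℕ, 1 < n →
      γ.integral α β ((X - C ξ) * polarJacobi α β ξ n * jacobiMonic α β 0) =
        4 * (Real.pi : ℂ) ^ 2 * Complex.exp (Real.pi * Complex.I * (α + β))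
          * (2 : ℂ) ^ (α + β + 1)
          / (Complex.Gamma (-α) * Complex.Gamma (-β) * Complex.Gamma (α + β + 2))
          * (jacobiMonic (α - 1) (β - 1) (n + 1)).eval ξ ∧
      ((∀ k : ℕ, α ≠ -((k : ℂ) + 1)) → (∀ k : ℕ, β ≠ -((k : ℂ) + 1)) →
        γ.integral α β ((X - C ξ) * polarJacobi α β ξ n * jacobiMonic α β 0) =
          -((1 - Complex.exp (2 * Real.pi * Complex.I * α))
              * (1 - Complex.exp (2 * Real.pi * Complex.I * β)))
            * ((2 : ℂ) ^ (α + β + 1) * Complex.Gamma (α + 1) * Complex.Gamma (β + 1)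
              / Complex.Gamma (α + β + 2))
            * (jacobiMonic (α - 1) (β - 1) (n + 1)).eval ξ) ∧
      (∀ m : ℕ, 0 < m → m + 1 < n →
        γ.integral α β ((X - C ξ) * polarJacobi α β ξ n * jacobiMonic α β m) = 0) ∧
      γ.integral α β ((X - C ξ) * polarJacobi α β ξ n * jacobiMonic α β (n - 1)) =
        gammaTilde α β n * γ.jacobiNormSq α β (n - 1) ∧
      γ.integral α β ((X - C ξ) * polarJacobi α β ξ n * jacobiMonic α β n) =
        betaTilde α β n * γ.jacobiNormSq α β n ∧
      γ.integral α β ((X - C ξ) * polarJacobi α β ξ n * jacobiMonic α β (n + 1)) =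
        γ.jacobiNormSq α β (n + 1) ∧
      (∀ m : ℕ, n + 1 < m →
        γ.integral α β ((X - C ξ) * polarJacobi α β ξ n * jacobiMonic α β m) = 0)) ∧
    -- the explicit value of the squared norm
    (∀ n : ℕ, γ.jacobiNormSq α β n =
      -(4 * (Real.pi : ℂ) ^ 2 * Complex.exp (Real.pi * Complex.I * (α + β)))
        * (2 : ℂ) ^ (2 * (n : ℂ) + α + β + 1) * (n.factorial : ℂ)
        / (Complex.Gamma (-α - n) * Complex.Gamma (-β - n)
          * (ascPochhammer ℂ n).eval (α + β + n + 1) * Complex.Gamma (α + β + 2 * n + 2))) ∧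
    ((∀ k : ℕ, α ≠ -((k : ℂ) + 1)) → (∀ k : ℕ, β ≠ -((k : ℂ) + 1)) →
      ∀ n : ℕ, (n = 0 → α + β ≠ -1) → γ.jacobiNormSq α β n =
        (1 - Complex.exp (2 * Real.pi * Complex.I * α))
          * (1 - Complex.exp (2 * Real.pi * Complex.I * β))
          * ((2 : ℂ) ^ (2 * (n : ℂ) + α + β + 1) * (n.factorial : ℂ)
            * Complex.Gamma (α + n + 1) * Complex.Gamma (β + n + 1)
            * Complex.Gamma (α + β + n + 1)
            / (Complex.Gamma (α + β + 2 * n + 1) * Complex.Gamma (α + β + 2 * n + 2)))) := by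
  refine ⟨fun n m => ?_, fun n hn => ⟨?_, fun hα hβ => ?_, fun m hm hmn => ?_, ?_, ?_, ?_,
    fun m hm => ?_⟩, γ.jacobiNormSq_eq hαβ, fun hα hβ n hn => γ.jacobiNormSq_eq_Gamma hαβ hα hβ n hn⟩
  · rw [polarOp_polarJacobi, mul_assoc, γ.integral_C_mul,
      γ.integral_jacobiMonic_mul_jacobiMonic hαβ, mul_ite, mul_zero]
  · rw [γ.integral_polarJacobi_mul_zero hαβ ξ hn, PochhammerContour.jacobiNormSq, jacobiMonic_zero,
      one_pow, γ.integral_one_eq, div_eq_mul_inv, mul_inv, mul_inv]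
    ring
  -- Only the total mass is involved here, and its denominator is `Γ(α + β + 2)`, so the case `α + β
  -- = -1` needs no exclusion.
  · have h := γ.integral_one_eq α β
    have h3 : ∀ a b c d e f x : ℂ, -(a * b) * (c * d * e / f) * x =
        -((a * d) * (b * e) * c * f⁻¹) * x := by intros; ring
    rw [γ.integral_polarJacobi_mul_zero hαβ ξ hn, PochhammerContour.jacobiNormSq, jacobiMonic_zero,
      one_pow, h, h3, one_sub_exp_mul_Gamma hα, one_sub_exp_mul_Gamma hβ, mul_add (_ * _) α β,
      Complex.exp_add, div_eq_mul_inv, div_eq_mul_inv]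
    linear_combination (4 * (Real.pi : ℂ) ^ 2 * Complex.exp (Real.pi * Complex.I * α)
      * Complex.exp (Real.pi * Complex.I * β) * (2 : ℂ) ^ (α + β + 1) * (Complex.Gamma (-α))⁻¹
      * (Complex.Gamma (-β))⁻¹ * (Complex.Gamma (α + β + 2))⁻¹
      * (jacobiMonic (α - 1) (β - 1) (n + 1)).eval ξ) * Complex.I_sq
  · rw [γ.integral_polarJacobi_mul hαβ ξ hn, if_neg (by omega), if_neg (by omega),
      if_neg (by omega), if_neg (by omega)]
    ring
  · rw [γ.integral_polarJacobi_mul hαβ ξ hn, if_neg (by omega), if_neg (by omega), if_pos rfl,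
      if_neg (by omega)]
    ring
  · rw [γ.integral_polarJacobi_mul hαβ ξ hn, if_neg (by omega), if_pos rfl, if_neg (by omega),
      if_neg (by omega)]
    ring
  · rw [γ.integral_polarJacobi_mul hαβ ξ hn, if_pos rfl, if_neg (by omega), if_neg (by omega),
      if_neg (by omega)]
    ring
  · rw [γ.integral_polarJacobi_mul hαβ ξ hn, if_neg (by omega), if_neg (by omega),
      if_neg (by omega), if_neg (by omega)]
    ring
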